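/- Let $0<a<\tfrac16$ and let $F:\mathbb R^2\to\mathbb R^2$ be $$F(x,y)=\bigl(x+2a\sin x+a\sin y,\; y+a\sin x+2a\sin y\bigr).$$ Put $S_{10}=\{-x\le y\le -x+2\pi,\ x-2\pi\le y\le x\}$, $s_1=\{x-\pi\le y\le x,\ -x\le y\le -x+\pi\}$ and $s_4=\{x-2\pi\le y\le x-\pi,\ -x+\pi\le y\le -x+2\pi\}$. A heteroclinic curve from a fixed point $p$ to a fixed point $q\ne p$ is a set $\gamma$ with $F(\gamma)=\gamma$ that is the image of an injective smooth ($C^\infty$) immersion $c:\mathbb R\to\mathbb R^2$ with $c(t)\to p$ as $t\to-\infty$ and $c(t)\to q$ as $t\to+\infty$, and each point $z$ of which has a full orbit $(X_n)_{n\in\mathbb Z}$, $X_0=z$, $X_{n+1}=F(X_n)$, with $X_n\to p$ as $n\to-\infty$ and $X_n\to q$ as $n\to+\infty$. For a neighbourhood $U$ of $(\pi,0)$ let $W^s_{\rm loc}$ be the set of points whose forward orbit stays in $U$ and converges to $(\pi,0)$, and let $W^s(\pi,0)=\bigcup_{n\ge0}F^{-n}(W^s_{\rm loc})$. The fixed points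 $(0,0)$ and $(2\pi,0)$ are unstable nodes (two real eigenvalues of modulus $>1$), $(\pi,0)$ is a saddle (one eigenvalue of modulus $<1$ and one of modulus $>1$), and $F(S_{10})=S_{10}$. There are sets $\gamma^L$ and $\gamma^R$ such that: 1. $\gamma^L\subset\operatorname{int}(s_1)$ is a heteroclinic curve from $(0,0)$ to $(\pi,0)$. 2. $\gamma^R=\{(2\pi-x,-y):(x,y)\in\gamma^L\}$, the image of $\gamma^L$ under the rotation by $\pi$ about $(\pi,0)$, is a heteroclinic curve from $(2\pi,0)$ to $(\pi,0)$, and $\gamma^R\subset\operatorname{int}(s_4)$. 3. For every $U$, $W^s(\pi,0)\cap\operatorname{int}(s_1)=\gamma^L$, $W^s(\pi,0)\cap s_1=\gamma^L\cup\{(\pi,0)\}$ and $W^s(\pi,0)=\gamma^L\cup\gamma^R\cup\{(\pi,0)\}$. Moreover there is an injective smooth immersion $c:\mathbb R\to\mathbb R^2$ with $c(0)=(\pi,0)$, $c'(0)=(2+\sqrt3,1)$, $c((-\infty,0))=\gamma^L$ and $c((0,\infty))=\gamma^R$. 4. Let $\eta=\gamma^L\cup\gamma^R\cup\{(\pi,0)\}$.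 Then $\overline\eta=\eta\cup\{(0,0),(2\pi,0)\}$, and $\operatorname{int}(S_{10})\setminus\eta$ is the disjoint union of two connected open sets, the points of $\operatorname{int}(S_{10})$ vertically above and those vertically below $\eta$, each of which is mapped by $F$ onto itself. Likewise $S_{10}\setminus\overline\eta$ is the disjoint union of the points of $S_{10}$ above $\eta$ and those below $\eta$, and $F$ maps each of these two sets onto itself. -/

import Mathlib

open Set Filter Topology
open scoped ContDiff

namespace AlignedClocks

noncomputable section

/-- The phase-difference map of three aligned clocks with coupling `a`. -/
def F (a : ℝ) (z : ℝ × ℝ) : ℝ × ℝ :=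
  (z.1 + 2 * a * Real.sin z.1 + a * Real.sin z.2,
   z.2 + a * Real.sin z.1 + 2 * a * Real.sin z.2)

/-- The invariant square with vertices `(0,0)`, `(π,π)`, `(2π,0)`, `(π,-π)`. -/
def S10 : Set (ℝ × ℝ) :=
  {z | (-z.1 ≤ z.2 ∧ z.2 ≤ -z.1 + 2 * Real.pi) ∧ (z.1 - 2 * Real.pi ≤ z.2 ∧ z.2 ≤ z.1)}

/-- The left one of the four small squares that make up `S10`. -/
def s1 : Set (ℝ × ℝ) :=
  {z | (z.1 - Real.pi ≤ z.2 ∧ z.2 ≤ z.1) ∧ (-z.1 ≤ z.2 ∧ z.2 ≤ -z.1 + Real.pi)}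

/-- The right one of the four small squares that make up `S10`. -/
def s4 : Set (ℝ × ℝ) :=
  {z | (z.1 - 2 * Real.pi ≤ z.2 ∧ z.2 ≤ z.1 - Real.pi) ∧
    (-z.1 + Real.pi ≤ z.2 ∧ z.2 ≤ -z.1 + 2 * Real.pi)}

/-- The internal symmetry of `S10`: the rotation by `π` about `(π,0)`. -/
def rot (z : ℝ × ℝ) : ℝ × ℝ := (2 * Real.pi - z.1, -z.2)

/-- A fixed point at which the derivative has two real eigenvalues, both outside the unit circle. -/
def IsUnstableNode (f : ℝ × ℝ → ℝ × ℝ) (p : ℝ × ℝ) : Prop :=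
  f p = p ∧ DifferentiableAt ℝ f p ∧ ∃ l m : ℝ, 1 < |l| ∧ 1 < |m| ∧
    (fderiv ℝ f p : (ℝ × ℝ) →ₗ[ℝ] (ℝ × ℝ)).charpoly =
      (Polynomial.X - Polynomial.C l) * (Polynomial.X - Polynomial.C m)

/-- A fixed point at which the derivative has one eigenvalue inside and one outside
the unit circle. -/
def IsSaddle (f : ℝ × ℝ → ℝ × ℝ) (p : ℝ × ℝ) : Prop :=
  f p = p ∧ DifferentiableAt ℝ f p ∧ ∃ l m : ℝ, |l| < 1 ∧ 1 < |m| ∧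
    (fderiv ℝ f p : (ℝ × ℝ) →ₗ[ℝ] (ℝ × ℝ)).charpoly =
      (Polynomial.X - Polynomial.C l) * (Polynomial.X - Polynomial.C m)

/-- The local stable manifold of `p` in the neighbourhood `U`: the points whose forward orbit
stays in `U` and converges to `p`. -/
def localStableManifold (f : ℝ × ℝ → ℝ × ℝ) (p : ℝ × ℝ) (U : Set (ℝ × ℝ)) : Set (ℝ × ℝ) :=
  {z | (∀ n : ℕ, f^[n] z ∈ U) ∧ Tendsto (fun n : ℕ => f^[n] z) atTop (𝓝 p)}

/-- The global stable manifold of `p`: the union of the preimages under the iterates of `f` of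
the local stable manifold in `U`. -/
def stableManifold (f : ℝ × ℝ → ℝ × ℝ) (p : ℝ × ℝ) (U : Set (ℝ × ℝ)) : Set (ℝ × ℝ) :=
  ⋃ n : ℕ, f^[n] ⁻¹' localStableManifold f p U

/-- An injectively immersed smooth curve. -/
def IsSmoothCurve (c : ℝ → ℝ × ℝ) : Prop :=
  ContDiff ℝ ∞ c ∧ Function.Injective c ∧ ∀ t, deriv c t ≠ 0

/-- `γ` is a heteroclinic curve of `f` from `p` to `q`: a strongly invariant smooth curve without
self-intersections that runs from `p` to `q`, each of whose points has a full orbit that tends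
to `p` in the past and to `q` in the future. -/
structure IsHeteroclinicCurve (f : ℝ × ℝ → ℝ × ℝ) (p q : ℝ × ℝ) (γ : Set (ℝ × ℝ)) : Prop where
  ne : p ≠ q
  fixed_left : f p = p
  fixed_right : f q = q
  curve : ∃ c : ℝ → ℝ × ℝ, IsSmoothCurve c ∧ range c = γ ∧
    Tendsto c atBot (𝓝 p) ∧ Tendsto c atTop (𝓝 q)
  invariant : f '' γ = γ
  orbit : ∀ z ∈ γ, ∃ X : ℤ → ℝ × ℝ, X 0 = z ∧ (∀ n, X (n + 1) = f (X n)) ∧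
    Tendsto X atBot (𝓝 p) ∧ Tendsto X atTop (𝓝 q)

/-- The points of `A` that lie vertically above a point of `η`. -/
def above (η A : Set (ℝ × ℝ)) : Set (ℝ × ℝ) := {z ∈ A | ∃ w ∈ η, w.1 = z.1 ∧ w.2 < z.2}

/-- The points of `A` that lie vertically below a point of `η`. -/
def below (η A : Set (ℝ × ℝ)) : Set (ℝ × ℝ) := {z ∈ A | ∃ w ∈ η, w.1 = z.1 ∧ z.2 < w.2}

/-- The curve `η` splits the interior of `A` into two disjoint domains, the part above and the
part below `η`, each strongly invariant under `f`; and the closure of `η` splits `A` itself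
into two disjoint strongly invariant sets. -/
structure SplitsInvariantly (f : ℝ × ℝ → ℝ × ℝ) (η A : Set (ℝ × ℝ)) : Prop where
  isOpen_above : IsOpen (above η (interior A))
  isOpen_below : IsOpen (below η (interior A))
  isConnected_above : IsConnected (above η (interior A))
  isConnected_below : IsConnected (below η (interior A))
  disjoint_interior : Disjoint (above η (interior A)) (below η (interior A))
  union_interior : above η (interior A) ∪ below η (interior A) = interior A \ η
  invariant_above : f '' above η (interior A) = above η (interior A)
  invariant_below : f '' below η (interior A) = below η (interior A)
  disjoint_self : Disjoint (above η A) (below η A)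
  union_self : above η A ∪ below η A = A \ closure η
  invariant_above_self : f '' above η A = above η A
  invariant_below_self : f '' below η A = below η A

end

end AlignedClocks

/-! In the diagonal coordinates `U = (x+y)/2`, `V = (x-y)/2` the map reads `u ↦ u + 3a sin u cos v`,
`v ↦ v + a sin v cos u`, and `S10` is the square `[0,π]²` with the saddle at its centre. Two facts
carry the proof: the saddle has a stable curve, and the dynamics on the square is competitive.

Existence. At the saddle the stable eigenvalue is `l = 1 - √3 a`. The conjugacy equation `F (φ t) =
φ (l t)` is rewritten, by inverting the linear part, as a fixed point equation. Its Picard iterates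
differ by terms of order `t³`, and on such terms the rescaling `t ↦ l t` more than compensates the
expansion of the inverse (`exists_picard_limit`, `exists_local_stable_curve`). The iterates are
entire functions converging uniformly on a complex disc, so the limit is holomorphic, hence smooth.
As `3a < 1/2`, `F` is a small Lipschitz perturbation of the identity and a diffeomorphism of the
plane, so pulling back by `F⁻¹` extends the curve to all parameters (`exists_isStableCurve`).

Geometry. On the square each component of `F` is increasing in its own diagonal variable and
decreasing in the other one, so `F` preserves the order `DiagLE`. Near the saddle, comparable points
do not get closer in the distance `ΔU - ΔV`. Comparable points of the basin would have to do so,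
hence they coincide (`eq_of_diagLE`): the basin is an antichain. Therefore `U` and `V` both increase
strictly along the stable curve, and the curve ends at fixed points, which must be corners. It thus
crosses every vertical line over `(0, 2π)`, and points on one vertical line are comparable, so the
curve is the whole basin (`IsStableCurve.range_eq`). The same order shows that `F` cannot carry a
point across the curve. The rotation `rot` commutes with `F` and transfers each statement to the
other half. -/

namespace AlignedClocks

noncomputable section

/-! ### The map as a diffeomorphism of the plane -/

/-- The derivative of `F a`. -/
def dF (a : ℝ) (z : ℝ × ℝ) : (ℝ × ℝ) →L[ℝ] (ℝ × ℝ) :=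
  ((1 + 2 * a * Real.cos z.1) • ContinuousLinearMap.fst ℝ ℝ ℝ +
    (a * Real.cos z.2) • ContinuousLinearMap.snd ℝ ℝ ℝ).prod
  ((a * Real.cos z.1) • ContinuousLinearMap.fst ℝ ℝ ℝ +
    (1 + 2 * a * Real.cos z.2) • ContinuousLinearMap.snd ℝ ℝ ℝ)

lemma dF_apply (a : ℝ) (z d : ℝ × ℝ) : dF a z d =
    ((1 + 2 * a * Real.cos z.1) * d.1 + a * Real.cos z.2 * d.2,
      a * Real.cos z.1 * d.1 + (1 + 2 * a * Real.cos z.2) * d.2) := by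
  simp [dF]

lemma hasFDerivAt_F (a : ℝ) (z : ℝ × ℝ) : HasFDerivAt (F a) (dF a z) z := by
  have h1 : HasFDerivAt (fun z : ℝ × ℝ => z.1) (ContinuousLinearMap.fst ℝ ℝ ℝ) z := hasFDerivAt_fst
  have h2 : HasFDerivAt (fun z : ℝ × ℝ => z.2) (ContinuousLinearMap.snd ℝ ℝ ℝ) z := hasFDerivAt_snd
  have h := ((h1.add (h1.sin.const_mul (2 * a))).add (h2.sin.const_mul a)).prodMk
    ((h2.add (h1.sin.const_mul a)).add (h2.sin.const_mul (2 * a)))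
  refine (h.congr_fderiv ?_)
  ext <;> simp [dF]

lemma contDiff_F (a : ℝ) : ContDiff ℝ ∞ (F a) := by
  unfold F
  fun_prop

lemma continuous_F (a : ℝ) : Continuous (F a) := (contDiff_F a).continuous

lemma abs_sin_sub_sin_le (x y : ℝ) : |Real.sin x - Real.sin y| ≤ |x - y| := by
  simpa [Real.dist_eq] using Real.lipschitzWith_sin.dist_le_mul x y

/-- In the sup norm the perturbation `F a - id` has Lipschitz constant at most `2a + a = 3a < 1/2`,
because the sine is 1-Lipschitz. This makes `F a` a global homeomorphism. -/
lemma approximatesLinearOn_F {a : ℝ} (ha0 : 0 < a) (ha1 : a < 1 / 6) :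
    ApproximatesLinearOn (F a)
      ((ContinuousLinearEquiv.refl ℝ (ℝ × ℝ) : (ℝ × ℝ) ≃L[ℝ] (ℝ × ℝ)) : (ℝ × ℝ) →L[ℝ] (ℝ × ℝ))
      univ (1 / 2) := by
  intro z _ w _
  have h1 := abs_sin_sub_sin_le z.1 w.1
  have h2 := abs_sin_sub_sin_le z.2 w.2
  have h3 : |z.1 - w.1| ≤ ‖z - w‖ := norm_fst_le (z - w)
  have h4 : |z.2 - w.2| ≤ ‖z - w‖ := norm_snd_le (z - w)
  have hn : (0 : ℝ) ≤ ‖z - w‖ := norm_nonneg _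
  have b1 := abs_le.1 (h1.trans h3)
  have b2 := abs_le.1 (h2.trans h4)
  have hs : F a z - F a w - (z - w) =
      (2 * a * (Real.sin z.1 - Real.sin w.1) + a * (Real.sin z.2 - Real.sin w.2),
        a * (Real.sin z.1 - Real.sin w.1) + 2 * a * (Real.sin z.2 - Real.sin w.2)) := by
    ext <;> simp [F] <;> ring
  have hk : 3 * a * ‖z - w‖ ≤ 1 / 2 * ‖z - w‖ := by nlinarith
  change ‖F a z - F a w - (z - w)‖ ≤ _
  rw [hs]
  refine norm_prod_le_iff.2 ⟨?_, ?_⟩ <;> rw [Real.norm_eq_abs, abs_le] <;>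
    push_cast <;> constructor <;> nlinarith

/-- `F a` as a homeomorphism of the plane. -/
def homeoF {a : ℝ} (ha0 : 0 < a) (ha1 : a < 1 / 6) : (ℝ × ℝ) ≃ₜ (ℝ × ℝ) :=
  (approximatesLinearOn_F ha0 ha1).toHomeomorph (F a) (Or.inr (by
    have h : ‖(((ContinuousLinearEquiv.refl ℝ (ℝ × ℝ)).symm : (ℝ × ℝ) ≃L[ℝ] (ℝ × ℝ)) :
        (ℝ × ℝ) →L[ℝ] (ℝ × ℝ))‖₊ = 1 := by
      have : ‖ContinuousLinearMap.id ℝ (ℝ × ℝ)‖₊ = 1 := ContinuousLinearMap.nnnorm_id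
      exact this
    rw [h, inv_one]
    exact NNReal.half_lt_self one_ne_zero))

lemma F_injective {a : ℝ} (ha0 : 0 < a) (ha1 : a < 1 / 6) : Function.Injective (F a) :=
  (homeoF ha0 ha1).injective

lemma F_surjective {a : ℝ} (ha0 : 0 < a) (ha1 : a < 1 / 6) : Function.Surjective (F a) :=
  (homeoF ha0 ha1).surjective

lemma dF_injective {a : ℝ} (ha0 : 0 < a) (ha1 : a < 1 / 6) (z : ℝ × ℝ) :
    Function.Injective (dF a z) := by
  refine (injective_iff_map_eq_zero _).2 fun d hd => ?_
  rw [dF_apply] at hd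
  obtain ⟨e1, e2⟩ := Prod.mk.inj hd
  set p := a * Real.cos z.1 with hp
  set q := a * Real.cos z.2 with hq
  have hp1 : |p| ≤ 1 / 6 := by
    rw [hp, abs_mul, abs_of_pos ha0]
    nlinarith [Real.abs_cos_le_one z.1, abs_nonneg (Real.cos z.1)]
  have hq1 : |q| ≤ 1 / 6 := by
    rw [hq, abs_mul, abs_of_pos ha0]
    nlinarith [Real.abs_cos_le_one z.2, abs_nonneg (Real.cos z.2)]
  rw [abs_le] at hp1 hq1
  -- With `|p|, |q| ≤ 1/6` the first product is at least `4/9` and the second at most `1/36`.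
  have hdet : 0 < (1 + 2 * p) * (1 + 2 * q) - p * q := by nlinarith
  have f1 : (1 + 2 * p) * d.1 + q * d.2 = 0 := by rw [hp]; linarith
  have f2 : p * d.1 + (1 + 2 * q) * d.2 = 0 := by rw [hq]; linarith
  have g1 : ((1 + 2 * p) * (1 + 2 * q) - p * q) * d.1 = 0 := by
    linear_combination (1 + 2 * q) * f1 - q * f2
  have g2 : ((1 + 2 * p) * (1 + 2 * q) - p * q) * d.2 = 0 := by
    linear_combination (1 + 2 * p) * f2 - p * f1
  ext
  · simpa using (mul_eq_zero.1 g1).resolve_left hdet.ne'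
  · simpa using (mul_eq_zero.1 g2).resolve_left hdet.ne'

lemma contDiff_homeoF_symm {a : ℝ} (ha0 : 0 < a) (ha1 : a < 1 / 6) :
    ContDiff ℝ ∞ (homeoF ha0 ha1).symm := by
  refine (homeoF ha0 ha1).contDiff_symm (f₀' := fun z =>
    (LinearEquiv.ofInjectiveEndo (dF a z : (ℝ × ℝ) →ₗ[ℝ] (ℝ × ℝ))
      (dF_injective ha0 ha1 z)).toContinuousLinearEquiv) (fun z => ?_) (contDiff_F a)
  refine (hasFDerivAt_F a z).congr_fderiv ?_
  ext <;> rfl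

/-! ### Type of the fixed points -/

lemma charpoly_dF (a : ℝ) (z : ℝ × ℝ) : (fderiv ℝ (F a) z : (ℝ × ℝ) →ₗ[ℝ] (ℝ × ℝ)).charpoly =
    Polynomial.X ^ 2
      - Polynomial.C ((1 + 2 * a * Real.cos z.1) + (1 + 2 * a * Real.cos z.2)) * Polynomial.X
      + Polynomial.C ((1 + 2 * a * Real.cos z.1) * (1 + 2 * a * Real.cos z.2)
          - (a * Real.cos z.2) * (a * Real.cos z.1)) := by
  rw [(hasFDerivAt_F a z).fderiv, ← LinearMap.charpoly_toMatrix _ (Module.Basis.finTwoProd ℝ),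
    Matrix.charpoly_fin_two, Matrix.trace_fin_two, Matrix.det_fin_two]
  simp [LinearMap.toMatrix_apply, dF_apply]

lemma X_sub_C_mul_X_sub_C (l m : ℝ) :
    (Polynomial.X - Polynomial.C l) * (Polynomial.X - Polynomial.C m) =
      Polynomial.X ^ 2 - Polynomial.C (l + m) * Polynomial.X + Polynomial.C (l * m) := by
  simp only [Polynomial.C_add, Polynomial.C_mul]
  ring

lemma isUnstableNode_of_cos_eq_one {a : ℝ} (ha0 : 0 < a) {z : ℝ × ℝ} (hz : F a z = z)
    (h1 : Real.cos z.1 = 1) (h2 : Real.cos z.2 = 1) : IsUnstableNode (F a) z := by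
  refine ⟨hz, (hasFDerivAt_F a z).differentiableAt, 1 + a, 1 + 3 * a, ?_, ?_, ?_⟩
  · exact lt_abs.2 (Or.inl (by linarith))
  · exact lt_abs.2 (Or.inl (by linarith))
  · rw [charpoly_dF, X_sub_C_mul_X_sub_C, h1, h2]
    ring_nf

lemma sqrt_three_bounds : 1.7 < √3 ∧ √3 < 1.8 ∧ √3 * √3 = 3 :=
  ⟨Real.lt_sqrt_of_sq_lt (by norm_num), (Real.sqrt_lt' (by norm_num)).2 (by norm_num),
    Real.mul_self_sqrt (by norm_num)⟩

lemma F_zero (a : ℝ) : F a (0, 0) = (0, 0) := by simp [F]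

lemma F_saddle (a : ℝ) : F a (Real.pi, 0) = (Real.pi, 0) := by simp [F]

lemma F_two_pi (a : ℝ) : F a (2 * Real.pi, 0) = (2 * Real.pi, 0) := by simp [F]

lemma isSaddle_pi {a : ℝ} (ha0 : 0 < a) (ha1 : a < 1 / 6) : IsSaddle (F a) (Real.pi, 0) := by
  obtain ⟨h1, h2, h3⟩ := sqrt_three_bounds
  refine ⟨F_saddle a, (hasFDerivAt_F a _).differentiableAt, 1 - √3 * a, 1 + √3 * a, ?_, ?_, ?_⟩
  · rw [abs_lt]
    constructor <;> nlinarith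
  · exact lt_abs.2 (Or.inl (by nlinarith))
  · rw [charpoly_dF, X_sub_C_mul_X_sub_C]
    have : (1 - √3 * a) * (1 + √3 * a) = 1 - 3 * a ^ 2 := by linear_combination (-a ^ 2) * h3
    rw [this]
    simp only [Real.cos_pi, Real.cos_zero]
    ring_nf

/-! ### Diagonal coordinates -/

/-- The first diagonal coordinate, half the sum of the coordinates. -/
def U (z : ℝ × ℝ) : ℝ := (z.1 + z.2) / 2

/-- The second diagonal coordinate, half the difference of the coordinates. -/
def V (z : ℝ × ℝ) : ℝ := (z.1 - z.2) / 2

/-- The diagonal coordinates as a homeomorphism. -/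
def diagHomeo : (ℝ × ℝ) ≃ₜ (ℝ × ℝ) where
  toFun z := (U z, V z)
  invFun w := (w.1 + w.2, w.1 - w.2)
  left_inv z := by ext <;> simp [U, V] <;> ring
  right_inv w := by ext <;> simp [U, V]
  continuous_toFun := by unfold U V; fun_prop
  continuous_invFun := by fun_prop

lemma continuous_U : Continuous U := by unfold U; fun_prop

lemma continuous_V : Continuous V := by unfold V; fun_prop

lemma ext_diag {z w : ℝ × ℝ} (hu : U z = U w) (hv : V z = V w) : z = w :=
  diagHomeo.injective (Prod.ext hu hv)

/-- A component of `F a` in diagonal coordinates. -/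
def comp (k u v : ℝ) : ℝ := u + k * (Real.sin u * Real.cos v)

lemma U_F (a : ℝ) (z : ℝ × ℝ) : U (F a z) = comp (3 * a) (U z) (V z) := by
  have h1 : z.1 = U z + V z := by simp [U, V]; ring
  have h2 : z.2 = U z - V z := by simp [U, V]; ring
  have : U (F a z) = (z.1 + z.2) / 2 + 3 * a * ((Real.sin z.1 + Real.sin z.2) / 2) := by
    simp only [U, F]; ring
  rw [this, h1, h2, Real.sin_add, Real.sin_sub, comp]
  ring

lemma V_F (a : ℝ) (z : ℝ × ℝ) : V (F a z) = comp a (V z) (U z) := by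
  have h1 : z.1 = U z + V z := by simp [U, V]; ring
  have h2 : z.2 = U z - V z := by simp [U, V]; ring
  have : V (F a z) = (z.1 - z.2) / 2 + a * ((Real.sin z.1 - Real.sin z.2) / 2) := by
    simp only [V, F]; ring
  rw [this, h1, h2, Real.sin_add, Real.sin_sub, comp]
  ring

lemma mem_S10 {z : ℝ × ℝ} :
    z ∈ S10 ↔ (0 ≤ U z ∧ U z ≤ Real.pi) ∧ (0 ≤ V z ∧ V z ≤ Real.pi) := by
  simp only [S10, U, V, mem_ofPred_eq]
  constructor <;> rintro ⟨⟨h1, h2⟩, h3, h4⟩ <;> refine ⟨⟨?_, ?_⟩, ?_, ?_⟩ <;> linarith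

lemma S10_eq : S10 = diagHomeo ⁻¹' (Icc 0 Real.pi ×ˢ Icc 0 Real.pi) := by
  ext z; exact mem_S10

lemma s1_eq : s1 = diagHomeo ⁻¹' (Icc 0 (Real.pi / 2) ×ˢ Icc 0 (Real.pi / 2)) := by
  ext z
  simp only [s1, diagHomeo, mem_ofPred_eq, mem_preimage, Homeomorph.homeomorph_mk_coe,
    Equiv.coe_fn_mk, mem_prod, mem_Icc, U, V]
  constructor <;> rintro ⟨⟨h1, h2⟩, h3, h4⟩ <;> refine ⟨⟨?_, ?_⟩, ?_, ?_⟩ <;> linarith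

lemma s4_eq : s4 = diagHomeo ⁻¹' (Icc (Real.pi / 2) Real.pi ×ˢ Icc (Real.pi / 2) Real.pi) := by
  ext z
  simp only [s4, diagHomeo, mem_ofPred_eq, mem_preimage, Homeomorph.homeomorph_mk_coe,
    Equiv.coe_fn_mk, mem_prod, mem_Icc, U, V]
  constructor <;> rintro ⟨⟨h1, h2⟩, h3, h4⟩ <;> refine ⟨⟨?_, ?_⟩, ?_, ?_⟩ <;> linarith

lemma mem_s1 {z : ℝ × ℝ} :
    z ∈ s1 ↔ (0 ≤ U z ∧ U z ≤ Real.pi / 2) ∧ (0 ≤ V z ∧ V z ≤ Real.pi / 2) := by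
  rw [s1_eq]; rfl

lemma mem_interior_S10 {z : ℝ × ℝ} : z ∈ interior S10 ↔
    (0 < U z ∧ U z < Real.pi) ∧ (0 < V z ∧ V z < Real.pi) := by
  rw [S10_eq, ← Homeomorph.preimage_interior, interior_prod_eq, interior_Icc]
  rfl

lemma mem_interior_s1 {z : ℝ × ℝ} : z ∈ interior s1 ↔
    (0 < U z ∧ U z < Real.pi / 2) ∧ (0 < V z ∧ V z < Real.pi / 2) := by
  rw [s1_eq, ← Homeomorph.preimage_interior, interior_prod_eq, interior_Icc]
  rfl

lemma mem_interior_s4 {z : ℝ × ℝ} : z ∈ interior s4 ↔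
    (Real.pi / 2 < U z ∧ U z < Real.pi) ∧ (Real.pi / 2 < V z ∧ V z < Real.pi) := by
  rw [s4_eq, ← Homeomorph.preimage_interior, interior_prod_eq, interior_Icc]
  rfl

lemma U_saddle : U (Real.pi, 0) = Real.pi / 2 := by simp [U]

lemma V_saddle : V (Real.pi, 0) = Real.pi / 2 := by simp [V]

lemma U_rot (z : ℝ × ℝ) : U (rot z) = Real.pi - U z := by simp [U, rot]; ring

lemma V_rot (z : ℝ × ℝ) : V (rot z) = Real.pi - V z := by simp [V, rot]; ring

lemma rot_rot (z : ℝ × ℝ) : rot (rot z) = z := by simp [rot]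

/-! ### Invariance of the squares -/

/-- The perturbation is at most `k|u|` in modulus with `k < 1`, so it cannot change the sign of `u`.
The other sides of the square follow from the symmetries `comp_neg` and `comp_pi_sub`, and the
equivalences yield invariance in both time directions. -/
lemma comp_pos_iff {k : ℝ} (hk0 : 0 ≤ k) (hk1 : k < 1) (u v : ℝ) : 0 < comp k u v ↔ 0 < u := by
  have hs : |k * (Real.sin u * Real.cos v)| ≤ k * |u| := by
    rw [abs_mul, abs_mul, abs_of_nonneg hk0]
    gcongr
    exact (mul_le_of_le_one_right (abs_nonneg _) (Real.abs_cos_le_one v)).trans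
      Real.abs_sin_le_abs
  obtain ⟨h1, h2⟩ := abs_le.1 hs
  unfold comp
  constructor
  · intro h
    by_contra! hu
    rw [abs_of_nonpos hu] at h1 h2
    nlinarith
  · intro hu
    rw [abs_of_pos hu] at h1 h2
    nlinarith

lemma comp_neg (k u v : ℝ) : comp k (-u) v = -comp k u v := by
  simp [comp]; ring

lemma comp_nonneg_iff {k : ℝ} (hk0 : 0 ≤ k) (hk1 : k < 1) (u v : ℝ) :
    0 ≤ comp k u v ↔ 0 ≤ u := by
  have := comp_pos_iff hk0 hk1 (-u) v
  rw [comp_neg, neg_pos, neg_pos] at this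
  rw [← not_lt, ← not_lt, this]

lemma comp_pi_sub (k u v : ℝ) : comp k (Real.pi - u) (Real.pi - v) = Real.pi - comp k u v := by
  simp [comp, Real.sin_pi_sub, Real.cos_pi_sub]; ring

lemma comp_lt_pi_iff {k : ℝ} (hk0 : 0 ≤ k) (hk1 : k < 1) (u v : ℝ) :
    comp k u v < Real.pi ↔ u < Real.pi := by
  have := comp_pos_iff hk0 hk1 (Real.pi - u) (Real.pi - v)
  rwa [comp_pi_sub, sub_pos, sub_pos] at this

lemma comp_le_pi_iff {k : ℝ} (hk0 : 0 ≤ k) (hk1 : k < 1) (u v : ℝ) :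
    comp k u v ≤ Real.pi ↔ u ≤ Real.pi := by
  have := comp_nonneg_iff hk0 hk1 (Real.pi - u) (Real.pi - v)
  rwa [comp_pi_sub, sub_nonneg, sub_nonneg] at this

lemma F_rot (a : ℝ) (z : ℝ × ℝ) : F a (rot z) = rot (F a z) := by
  refine ext_diag ?_ ?_
  · rw [U_F, U_rot, U_rot, V_rot, U_F, comp_pi_sub]
  · rw [V_F, V_rot, U_rot, V_rot, V_F, comp_pi_sub]

lemma F_mem_S10_iff {a : ℝ} (ha0 : 0 < a) (ha1 : a < 1 / 6) (z : ℝ × ℝ) :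
    F a z ∈ S10 ↔ z ∈ S10 := by
  rw [mem_S10, mem_S10, U_F, V_F, comp_nonneg_iff, comp_nonneg_iff, comp_le_pi_iff,
    comp_le_pi_iff] <;> linarith

lemma F_mem_interior_S10_iff {a : ℝ} (ha0 : 0 < a) (ha1 : a < 1 / 6) (z : ℝ × ℝ) :
    F a z ∈ interior S10 ↔ z ∈ interior S10 := by
  rw [mem_interior_S10, mem_interior_S10, U_F, V_F, comp_pos_iff, comp_pos_iff, comp_lt_pi_iff,
    comp_lt_pi_iff] <;> linarith

lemma image_eq_of_mem_iff {α : Type*} {f : α → α} (hf : Function.Surjective f) {s : Set α}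
    (h : ∀ z, f z ∈ s ↔ z ∈ s) : f '' s = s := by
  have : f ⁻¹' s = s := Set.ext h
  conv_lhs => rw [← this]
  exact image_preimage_eq s hf

/-! ### An analytic linearization of the map along the stable direction -/

/-- The higher order part of the sine, applied to both coordinates. -/
def sinRem (w : ℂ × ℂ) : ℂ × ℂ := (Complex.sin w.1 - w.1, Complex.sin w.2 - w.2)

/-- The difference is the average of the second order remainders of `exp` at `iz` and `-iz`. As the
derivative of `sin z - z`, it gives the quadratically small Lipschitz constant of `sinRem`. -/
lemma norm_cos_sub_one_le {z : ℂ} (hz : ‖z‖ ≤ 1) : ‖Complex.cos z - 1‖ ≤ ‖z‖ ^ 2 := by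
  have h1 := Complex.norm_exp_sub_one_sub_id_le (x := z * Complex.I) (by simpa using hz)
  have h2 := Complex.norm_exp_sub_one_sub_id_le (x := -z * Complex.I) (by simpa using hz)
  have e : Complex.cos z - 1 = ((Complex.exp (z * Complex.I) - 1 - z * Complex.I) +
      (Complex.exp (-z * Complex.I) - 1 - -z * Complex.I)) / 2 := by
    rw [Complex.cos]; ring
  simp only [norm_mul, norm_neg, Complex.norm_I, mul_one] at h1 h2
  rw [e, norm_div, Complex.norm_ofNat]
  have := norm_add_le (Complex.exp (z * Complex.I) - 1 - z * Complex.I)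
    (Complex.exp (-z * Complex.I) - 1 - -z * Complex.I)
  linarith

lemma norm_sin_sub_id_sub_le {r : ℝ} (hr : r ≤ 1) {z w : ℂ} (hz : ‖z‖ ≤ r) (hw : ‖w‖ ≤ r) :
    ‖(Complex.sin z - z) - (Complex.sin w - w)‖ ≤ r ^ 2 * ‖z - w‖ := by
  have hd : ∀ x : ℂ, HasDerivAt (fun z : ℂ => Complex.sin z - z) (Complex.cos x - 1) x :=
    fun x => (Complex.hasDerivAt_sin x).sub (hasDerivAt_id x)
  refine Convex.norm_image_sub_le_of_norm_deriv_le (f := fun z : ℂ => Complex.sin z - z)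
    (s := Metric.closedBall 0 r) (fun x _ => (hd x).differentiableAt) (fun x hx => ?_)
    (convex_closedBall 0 r) (by simpa using hw) (by simpa using hz)
  rw [(hd x).deriv]
  have hx : ‖x‖ ≤ r := by simpa using hx
  exact (norm_cos_sub_one_le (hx.trans hr)).trans (by gcongr)

lemma norm_sinRem_sub_le {r : ℝ} (hr : r ≤ 1) {z w : ℂ × ℂ} (hz : ‖z‖ ≤ r) (hw : ‖w‖ ≤ r) :
    ‖sinRem z - sinRem w‖ ≤ r ^ 2 * ‖z - w‖ := by
  refine norm_prod_le_iff.2 ⟨?_, ?_⟩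
  · exact (norm_sin_sub_id_sub_le hr ((norm_fst_le z).trans hz) ((norm_fst_le w).trans hw)).trans
      (by gcongr; exact norm_fst_le (z - w))
  · exact (norm_sin_sub_id_sub_le hr ((norm_snd_le z).trans hz) ((norm_snd_le w).trans hw)).trans
      (by gcongr; exact norm_snd_le (z - w))

lemma sinRem_zero : sinRem 0 = 0 := by simp [sinRem]

lemma sinRem_neg (w : ℂ × ℂ) : sinRem (-w) = -sinRem w := by
  ext <;> simp [sinRem] <;> ring

lemma norm_sinRem_le {z : ℂ × ℂ} (hz : ‖z‖ ≤ 1) : ‖sinRem z‖ ≤ ‖z‖ ^ 3 := by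
  have := norm_sinRem_sub_le hz (le_refl ‖z‖) (w := 0) (by simp)
  rw [sinRem_zero, sub_zero, sub_zero] at this
  linarith [pow_succ ‖z‖ 2]

lemma differentiable_sinRem : Differentiable ℂ sinRem := by
  unfold sinRem
  fun_prop

/-- The iterates that approximate the solution of `Φ t = L (Φ (l t)) - N (sinRem (Φ t))`. -/
def picard (L N : ℂ × ℂ →L[ℂ] ℂ × ℂ) (l : ℝ) (v : ℂ × ℂ) : ℕ → ℂ → ℂ × ℂ
  | 0, t => t • v
  | n + 1, t => L (picard L N l v n (l * t)) - N (sinRem (picard L N l v n t))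

section Picard

variable {L N : ℂ × ℂ →L[ℂ] ℂ × ℂ} {l : ℝ} {v : ℂ × ℂ}

lemma picard_succ (n : ℕ) (t : ℂ) : picard L N l v (n + 1) t =
    L (picard L N l v n (l * t)) - N (sinRem (picard L N l v n t)) := rfl

lemma differentiable_picard (n : ℕ) : Differentiable ℂ (picard L N l v n) := by
  induction n with
  | zero => exact (differentiable_id.smul_const v : Differentiable ℂ fun t : ℂ => t • v)
  | succ n ih =>
    have h1 : Differentiable ℂ fun t : ℂ => picard L N l v n (l * t) := by fun_prop
    have h2 : Differentiable ℂ fun t : ℂ => sinRem (picard L N l v n t) :=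
      differentiable_sinRem.comp ih
    exact (L.differentiable.comp h1).sub (N.differentiable.comp h2)

lemma picard_neg (n : ℕ) (t : ℂ) : picard L N l v n (-t) = -picard L N l v n t := by
  induction n generalizing t with
  | zero => simp [picard]
  | succ n ih =>
    simp only [picard, mul_neg, ih, sinRem_neg, map_neg]
    abel

/-- The two bounds need each other: summing the increments as a geometric series, with `64 / (δ/2) =
128/δ`, bounds the distance to the linear term, and that bound keeps the iterates in a ball where
`sinRem` is a strong contraction. `L` need not contract, but the increments are cubic in `t`, so the
rescaling by `l` turns its factor `κ` into `κ l³ = 1 - δ`. -/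
lemma picard_bounds {κ δ : ℝ} (hl0 : 0 < l) (hl1 : l < 1) (hκ : 0 ≤ κ) (hδ0 : 0 < δ)
    (hδ : κ * l ^ 3 = 1 - δ) (hL : ∀ w, ‖L w‖ ≤ κ * ‖w‖) (hN : ∀ w, ‖N w‖ ≤ ‖w‖)
    (hv : ‖v‖ ≤ 4) (hLv : L ((l : ℂ) • v) = v) (n : ℕ) (t : ℂ) (ht : ‖t‖ ≤ δ / 16) :
    ‖picard L N l v n t - t • v‖ ≤ 128 * (1 - (1 - δ / 2) ^ n) / δ * ‖t‖ ^ 3 ∧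
    ‖picard L N l v (n + 1) t - picard L N l v n t‖ ≤ 64 * (1 - δ / 2) ^ n * ‖t‖ ^ 3 := by
  have hδ1 : δ ≤ 1 := by
    have : 0 ≤ κ * l ^ 3 := by positivity
    linarith
  have hθ0 : 0 ≤ 1 - δ / 2 := by linarith
  -- The linear term has norm at most `4‖t‖`, and the radius `δ/16` makes the cubic correction at
  -- most `(δ/2)‖t‖`.
  have size : ∀ n (t : ℂ), ‖t‖ ≤ δ / 16 →
      ‖picard L N l v n t - t • v‖ ≤ 128 * (1 - (1 - δ / 2) ^ n) / δ * ‖t‖ ^ 3 →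
      ‖picard L N l v n t‖ ≤ 5 * ‖t‖ := by
    intro n t ht h
    have h0 : ‖t‖ ^ 2 ≤ (δ / 16) ^ 2 := by gcongr
    have h1 : 128 * (1 - (1 - δ / 2) ^ n) / δ * ‖t‖ ^ 3 ≤ ‖t‖ := by
      have hp : 0 ≤ (1 - δ / 2) ^ n := by positivity
      calc 128 * (1 - (1 - δ / 2) ^ n) / δ * ‖t‖ ^ 3
          ≤ 128 * 1 / δ * ‖t‖ ^ 3 := by gcongr; linarith
        _ = 128 / δ * ‖t‖ ^ 2 * ‖t‖ := by ring
        _ ≤ 128 / δ * (δ / 16) ^ 2 * ‖t‖ := by gcongr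
        _ = δ / 2 * ‖t‖ := by field_simp; ring
        _ ≤ ‖t‖ := by nlinarith [norm_nonneg t]
    have h2 : ‖t • v‖ ≤ 4 * ‖t‖ := by
      rw [norm_smul]; nlinarith [norm_nonneg t]
    have h3 := norm_add_le (picard L N l v n t - t • v) (t • v)
    rw [sub_add_cancel] at h3
    linarith
  induction n generalizing t with
  | zero =>
    refine ⟨by simp [picard], ?_⟩
    -- The eigenvector relation cancels the linear terms, so the first increment is already cubic;
    -- its constant is `64 = 4³`.
    have e : picard L N l v 1 t - picard L N l v 0 t = -N (sinRem (t • v)) := by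
      have : ((l : ℂ) * t) • v = t • ((l : ℂ) • v) := by rw [smul_smul, mul_comm]
      simp only [picard, this, map_smul L t, hLv]
      abel
    have h2 : ‖t • v‖ ≤ 4 * ‖t‖ := by
      rw [norm_smul]; nlinarith [norm_nonneg t]
    rw [e, norm_neg]
    calc ‖N (sinRem (t • v))‖ ≤ ‖sinRem (t • v)‖ := hN _
      _ ≤ ‖t • v‖ ^ 3 := norm_sinRem_le (by linarith)
      _ ≤ (4 * ‖t‖) ^ 3 := by gcongr
      _ = _ := by ring
  | succ n ih =>
    have first : ∀ t : ℂ, ‖t‖ ≤ δ / 16 → ‖picard L N l v (n + 1) t - t • v‖ ≤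
        128 * (1 - (1 - δ / 2) ^ (n + 1)) / δ * ‖t‖ ^ 3 := by
      intro t ht
      obtain ⟨i1, i2⟩ := ih t ht
      have h3 := norm_add_le (picard L N l v (n + 1) t - picard L N l v n t)
        (picard L N l v n t - t • v)
      rw [sub_add_sub_cancel] at h3
      refine h3.trans ((add_le_add i2 i1).trans (le_of_eq ?_))
      field_simp
      ring
    refine ⟨first t ht, ?_⟩
    have hlt : ‖(l : ℂ) * t‖ = l * ‖t‖ := by
      rw [norm_mul, Complex.norm_real, Real.norm_of_nonneg hl0.le]
    have hlt' : ‖(l : ℂ) * t‖ ≤ δ / 16 := by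
      rw [hlt]; nlinarith [norm_nonneg t]
    obtain ⟨i1, i2⟩ := ih t ht
    obtain ⟨-, j2⟩ := ih _ hlt'
    rw [hlt] at j2
    have s1 : ‖picard L N l v n t‖ ≤ 5 * (δ / 16) := (size n t ht i1).trans (by linarith)
    have s2 : ‖picard L N l v (n + 1) t‖ ≤ 5 * (δ / 16) :=
      (size (n + 1) t ht (first t ht)).trans (by linarith)
    have e : picard L N l v (n + 1 + 1) t - picard L N l v (n + 1) t =
        L (picard L N l v (n + 1) (l * t) - picard L N l v n (l * t)) -
        N (sinRem (picard L N l v (n + 1) t) - sinRem (picard L N l v n t)) := by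
      rw [map_sub, map_sub, picard_succ (n + 1) t, picard_succ n t]
      abel
    rw [e]
    have q1 := (hL (picard L N l v (n + 1) (l * t) - picard L N l v n (l * t))).trans
      (mul_le_mul_of_nonneg_left j2 hκ)
    have q2 := (hN (sinRem (picard L N l v (n + 1) t) - sinRem (picard L N l v n t))).trans
      ((norm_sinRem_sub_le (by linarith) s2 s1).trans (mul_le_mul_of_nonneg_left i2 (sq_nonneg _)))
    refine (norm_sub_le _ _).trans ((add_le_add q1 q2).trans ?_)
    have hp : 0 ≤ 64 * (1 - δ / 2) ^ n * ‖t‖ ^ 3 := by positivity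
    -- The ratio is `1 - δ` from `L` plus `25δ²/256 ≤ δ/2` from `N`.
    calc κ * (64 * (1 - δ / 2) ^ n * (l * ‖t‖) ^ 3) +
          (5 * (δ / 16)) ^ 2 * (64 * (1 - δ / 2) ^ n * ‖t‖ ^ 3)
        = (κ * l ^ 3 + 25 / 256 * δ ^ 2) * (64 * (1 - δ / 2) ^ n * ‖t‖ ^ 3) := by ring
      _ ≤ (1 - δ / 2) * (64 * (1 - δ / 2) ^ n * ‖t‖ ^ 3) := by
          gcongr
          nlinarith
      _ = _ := by ring

theorem exists_picard_limit {κ : ℝ} (hl0 : 0 < l) (hl1 : l < 1) (hκ : 0 ≤ κ)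
    (hκl : κ * l ^ 3 < 1) (hL : ∀ w, ‖L w‖ ≤ κ * ‖w‖) (hN : ∀ w, ‖N w‖ ≤ ‖w‖)
    (hv : ‖v‖ ≤ 4) (hLv : L ((l : ℂ) • v) = v) :
    ∃ ρ > 0, ∃ C, ∃ Φ : ℂ → ℂ × ℂ, DifferentiableOn ℂ Φ (Metric.ball 0 ρ) ∧
      (∀ t ∈ Metric.ball (0 : ℂ) ρ, Φ t = L (Φ (l * t)) - N (sinRem (Φ t))) ∧
      (∀ t ∈ Metric.ball (0 : ℂ) ρ, ‖Φ t - t • v‖ ≤ C * ‖t‖ ^ 3) ∧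
      ∀ t ∈ Metric.ball (0 : ℂ) ρ, Tendsto (fun n => picard L N l v n t) atTop (𝓝 (Φ t)) := by
  obtain ⟨δ, hδ⟩ : ∃ δ, δ = 1 - κ * l ^ 3 := ⟨_, rfl⟩
  have hδ0 : 0 < δ := by linarith
  have hb := picard_bounds hl0 hl1 hκ hδ0 (by linarith) hL hN hv hLv
  have hδ1 : δ ≤ 1 := by
    have : 0 ≤ κ * l ^ 3 := by positivity
    linarith
  have hθ : 1 - δ / 2 < 1 := by linarith
  have hgeom : ∀ t : ℂ, ‖t‖ ≤ δ / 16 → ∀ n, dist (picard L N l v n t)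
      (picard L N l v (n + 1) t) ≤ 64 * ‖t‖ ^ 3 * (1 - δ / 2) ^ n := fun t ht n => by
    rw [dist_comm, dist_eq_norm]
    exact (hb n t ht).2.trans (le_of_eq (by ring))
  have hlim : ∀ t : ℂ, ‖t‖ ≤ δ / 16 → Tendsto (fun n => picard L N l v n t) atTop
      (𝓝 (limUnder atTop fun n => picard L N l v n t)) := fun t ht =>
    CauchySeq.tendsto_limUnder (cauchySeq_of_le_geometric _ _ hθ (hgeom t ht))
  have hball : ∀ t ∈ Metric.ball (0 : ℂ) (δ / 16), ‖t‖ ≤ δ / 16 := fun t ht => by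
    rw [mem_ball_zero_iff] at ht
    exact ht.le
  refine ⟨δ / 16, by positivity, 128 / δ, fun t => limUnder atTop fun n => picard L N l v n t,
    ?_, fun t ht => ?_, fun t ht => ?_, fun t ht => hlim t (hball t ht)⟩
  · refine TendstoLocallyUniformlyOn.differentiableOn (F := fun n => picard L N l v n)
      (φ := atTop) (TendstoUniformlyOn.tendstoLocallyUniformlyOn ?_)
      (Eventually.of_forall fun n => (differentiable_picard n).differentiableOn)
      Metric.isOpen_ball
    rw [Metric.tendstoUniformlyOn_iff]
    intro ε hε
    have h0 : Tendsto (fun n : ℕ => 64 * (δ / 16) ^ 3 * (1 - δ / 2) ^ n / (1 - (1 - δ / 2))) atTop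
        (𝓝 (64 * (δ / 16) ^ 3 * 0 / (1 - (1 - δ / 2)))) :=
      ((tendsto_pow_atTop_nhds_zero_of_lt_one (by linarith) hθ).const_mul _).div_const _
    rw [mul_zero, zero_div] at h0
    filter_upwards [h0.eventually (gt_mem_nhds hε)] with n hn t ht
    have ht' := hball t ht
    rw [dist_comm]
    refine lt_of_le_of_lt (dist_le_of_le_geometric_of_tendsto _ _ hθ (fun n =>
      (hgeom t ht' n).trans ?_) (hlim t ht') n) hn
    have : 0 ≤ 1 - δ / 2 := by linarith
    gcongr
  · have ht' := hball t ht
    have hlt' : ‖(l : ℂ) * t‖ ≤ δ / 16 := by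
      rw [norm_mul, Complex.norm_real, Real.norm_of_nonneg hl0.le]
      nlinarith [norm_nonneg t]
    refine tendsto_nhds_unique ((tendsto_add_atTop_iff_nat 1).2 (hlim t ht')) ?_
    exact ((L.continuous.tendsto _).comp (hlim _ hlt')).sub ((N.continuous.tendsto _).comp
      ((differentiable_sinRem.continuous.tendsto _).comp (hlim t ht')))
  · have ht' := hball t ht
    refine le_of_tendsto ((hlim t ht').sub_const _).norm (Eventually.of_forall fun n => ?_)
    refine (hb n t ht').1.trans ?_
    have : 0 ≤ 1 - δ / 2 := by linarith
    have : 0 ≤ (1 - δ / 2) ^ n := by positivity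
    gcongr
    linarith

/-- The linear map of the complex plane given by a real matrix. -/
def linC (p q r s : ℝ) : ℂ × ℂ →L[ℂ] ℂ × ℂ :=
  ((p : ℂ) • ContinuousLinearMap.fst ℂ ℂ ℂ + (q : ℂ) • ContinuousLinearMap.snd ℂ ℂ ℂ).prod
  ((r : ℂ) • ContinuousLinearMap.fst ℂ ℂ ℂ + (s : ℂ) • ContinuousLinearMap.snd ℂ ℂ ℂ)

lemma linC_apply (p q r s : ℝ) (w : ℂ × ℂ) :
    linC p q r s w = (p * w.1 + q * w.2, r * w.1 + s * w.2) := by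
  simp [linC]

lemma norm_linC_le {p q r s K : ℝ} (h1 : |p| + |q| ≤ K) (h2 : |r| + |s| ≤ K) (w : ℂ × ℂ) :
    ‖linC p q r s w‖ ≤ K * ‖w‖ := by
  have key : ∀ p q : ℝ, |p| + |q| ≤ K → ‖(p : ℂ) * w.1 + q * w.2‖ ≤ K * ‖w‖ := by
    intro p q h
    refine (norm_add_le _ _).trans ?_
    rw [norm_mul, norm_mul, Complex.norm_real, Complex.norm_real, Real.norm_eq_abs,
      Real.norm_eq_abs]
    have := mul_le_mul_of_nonneg_left (norm_fst_le w) (abs_nonneg p)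
    have := mul_le_mul_of_nonneg_left (norm_snd_le w) (abs_nonneg q)
    nlinarith [norm_nonneg w]
  rw [linC_apply]
  exact norm_prod_le_iff.2 ⟨key p q h1, key r s h2⟩

/-- The pairs of complex numbers with real entries. -/
def realPairs : Set (ℂ × ℂ) := {w | w.1.im = 0 ∧ w.2.im = 0}

lemma isClosed_realPairs : IsClosed realPairs :=
  (isClosed_eq (by fun_prop) continuous_const).inter (isClosed_eq (by fun_prop) continuous_const)

lemma linC_mem_realPairs {p q r s : ℝ} {w : ℂ × ℂ} (hw : w ∈ realPairs) :
    linC p q r s w ∈ realPairs := by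
  obtain ⟨h1, h2⟩ := hw
  rw [linC_apply]
  constructor <;> simp [h1, h2]

lemma sub_mem_realPairs {w z : ℂ × ℂ} (hw : w ∈ realPairs) (hz : z ∈ realPairs) :
    w - z ∈ realPairs := by
  obtain ⟨h1, h2⟩ := hw
  obtain ⟨h3, h4⟩ := hz
  constructor <;> simp [h1, h2, h3, h4]

lemma eq_ofReal_of_mem_realPairs {w : ℂ × ℂ} (hw : w ∈ realPairs) :
    w = ((w.1.re : ℂ), (w.2.re : ℂ)) := by
  obtain ⟨h1, h2⟩ := hw
  ext1 <;> apply Complex.ext <;> simp [h1, h2]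

lemma sinRem_ofReal (x y : ℝ) :
    sinRem ((x : ℂ), (y : ℂ)) = (((Real.sin x - x : ℝ) : ℂ), ((Real.sin y - y : ℝ) : ℂ)) := by
  simp [sinRem]

lemma sinRem_mem_realPairs {w : ℂ × ℂ} (hw : w ∈ realPairs) : sinRem w ∈ realPairs := by
  rw [eq_ofReal_of_mem_realPairs hw, sinRem_ofReal]
  constructor <;> simp only [Complex.ofReal_im]

lemma picard_mem_realPairs {p q r s p' q' r' s' : ℝ} (hv : v ∈ realPairs) (n : ℕ) (t : ℝ) :
    picard (linC p q r s) (linC p' q' r' s') l v n t ∈ realPairs := by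
  induction n generalizing t with
  | zero =>
    obtain ⟨h1, h2⟩ := hv
    constructor <;> simp [picard, h1, h2]
  | succ n ih =>
    have h := ih (l * t)
    rw [Complex.ofReal_mul] at h
    exact sub_mem_realPairs (linC_mem_realPairs h)
      (linC_mem_realPairs (sinRem_mem_realPairs (ih t)))

end Picard

/-- The stable eigenvalue of `F a` at the saddle. -/
def stableEig (a : ℝ) : ℝ := 1 - √3 * a

lemma stableEig_pos {a : ℝ} (ha0 : 0 < a) (ha1 : a < 1 / 6) : 0 < stableEig a := by
  obtain ⟨h1, h2, -⟩ := sqrt_three_bounds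
  unfold stableEig
  nlinarith

lemma stableEig_lt_one {a : ℝ} (ha0 : 0 < a) : stableEig a < 1 := by
  have : 0 < √3 * a := by positivity
  unfold stableEig
  linarith

/-- With `x = φ - (π,0)`, the conjugacy equation is `M x(t) + B sinRem(x(t)) = x(l t)`, where `M =
[[1-2a, a], [-a, 1+2a]]` is the derivative at the saddle and `B = [[-2a, a], [-a, 2a]]`. Multiplying
by `M⁻¹` gives the Picard form with `L = M⁻¹` and `N = M⁻¹B`; here `d` is the inverse of `det M = 1
- 3a²`. Real entries and oddness pass from the iterates to the limit, which makes the curve real and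
symmetric under `rot`. -/
theorem exists_local_stable_curve {a : ℝ} (ha0 : 0 < a) (ha1 : a < 1 / 6) :
    ∃ ρ > 0, ∃ φ : ℝ → ℝ × ℝ, ContDiffOn ℝ ∞ φ (Ioo (-ρ) ρ) ∧ φ 0 = (Real.pi, 0) ∧
      HasDerivAt φ (2 + √3, 1) 0 ∧ (∀ t ∈ Ioo (-ρ) ρ, φ (-t) = rot (φ t)) ∧
      ∀ t ∈ Ioo (-ρ) ρ, F a (φ t) = φ (stableEig a * t) := by
  obtain ⟨b1, b2, b3⟩ := sqrt_three_bounds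
  have hl0 := stableEig_pos ha0 ha1
  have hl1 := stableEig_lt_one ha0
  have hD : 0 < 1 - 3 * a ^ 2 := by nlinarith
  obtain ⟨d, hd⟩ : ∃ d, d = (1 - 3 * a ^ 2)⁻¹ := ⟨_, rfl⟩
  have hd0 : 0 < d := by rw [hd]; positivity
  have hdD : d * (1 - 3 * a ^ 2) = 1 := by rw [hd]; exact inv_mul_cancel₀ hD.ne'
  have hlD : stableEig a * (1 + √3 * a) = 1 - 3 * a ^ 2 := by
    unfold stableEig; linear_combination (-a ^ 2) * b3
  -- The larger row sum of `L` is `κ = d(1+3a)`. The determinant factors as `l(1 + √3 a)`, so it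
  -- remains to compare `(1+3a) l²` with the unstable eigenvalue.
  have hκl : d * (1 + 3 * a) * stableEig a ^ 3 < 1 := by
    have h1 : (1 + 3 * a) * stableEig a ^ 2 < 1 + √3 * a := by
      have : stableEig a ^ 2 = 1 - 2 * (√3 * a) + 3 * a ^ 2 := by
        unfold stableEig; linear_combination (a ^ 2) * b3
      rw [this]
      nlinarith [mul_pos ha0 ha0, mul_pos (mul_pos ha0 ha0) ha0]
    calc d * (1 + 3 * a) * stableEig a ^ 3
        = d * stableEig a * ((1 + 3 * a) * stableEig a ^ 2) := by ring
      _ < d * stableEig a * (1 + √3 * a) := by gcongr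
      _ = 1 := by rw [mul_assoc, hlD, hdD]
  obtain ⟨v, hvd⟩ : ∃ v : ℂ × ℂ, v = (((2 + √3 : ℝ) : ℂ), ((1 : ℝ) : ℂ)) := ⟨_, rfl⟩
  have hvr : v ∈ realPairs := by rw [hvd]; exact ⟨Complex.ofReal_im _, Complex.ofReal_im _⟩
  have hv4 : ‖v‖ ≤ 4 := by
    rw [hvd]
    refine norm_prod_le_iff.2 ⟨?_, ?_⟩ <;> rw [Complex.norm_real, Real.norm_eq_abs, abs_le] <;>
      constructor <;> linarith
  have hL : ∀ w, ‖linC (d * (1 + 2 * a)) (-(d * a)) (d * a) (d * (1 - 2 * a)) w‖ ≤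
      d * (1 + 3 * a) * ‖w‖ := by
    have e1 : 0 < d * (1 + 2 * a) := by positivity
    have e2 : 0 < d * a := by positivity
    have e3 : 0 < d * (1 - 2 * a) := mul_pos hd0 (by linarith)
    refine norm_linC_le ?_ ?_
    · rw [abs_neg, abs_of_pos e1, abs_of_pos e2]; linarith
    · rw [abs_of_pos e2, abs_of_pos e3]; nlinarith
  have hN : ∀ w, ‖linC (-(d * (2 * a + 3 * a ^ 2))) (d * a) (-(d * a))
      (d * (2 * a - 3 * a ^ 2)) w‖ ≤ ‖w‖ := by
    intro w
    have e1 : 0 < d * (2 * a + 3 * a ^ 2) := by positivity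
    have e2 : 0 < d * a := by positivity
    have e3 : 0 < d * (2 * a - 3 * a ^ 2) := mul_pos hd0 (by nlinarith)
    have e4 : d * (2 * a + 3 * a ^ 2) + d * a ≤ 1 := by
      rw [← hdD, ← mul_add]
      exact mul_le_mul_of_nonneg_left (by nlinarith) hd0.le
    rw [← one_mul ‖w‖]
    refine norm_linC_le ?_ ?_ w
    · rw [abs_neg, abs_of_pos e1, abs_of_pos e2]; exact e4
    · rw [abs_neg, abs_of_pos e2, abs_of_pos e3]; nlinarith
  have hLv : linC (d * (1 + 2 * a)) (-(d * a)) (d * a) (d * (1 - 2 * a))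
      ((stableEig a : ℂ) • v) = v := by
    rw [linC_apply, hvd]
    refine Prod.ext ?_ ?_
    · simp only [Prod.smul_mk, smul_eq_mul]
      norm_cast
      have : (1 + 2 * a) * (2 + √3) - a = (2 + √3) * (1 + √3 * a) := by
        linear_combination (-a) * b3
      linear_combination d * stableEig a * this + d * (2 + √3) * hlD + (2 + √3) * hdD
    · simp only [Prod.smul_mk, smul_eq_mul]
      norm_cast
      linear_combination d * hlD + hdD
  obtain ⟨ρ, hρ, C, Φ, hΦd, hΦe, hΦC, hΦl⟩ :=
    exists_picard_limit hl0 hl1 (by positivity) hκl hL hN hv4 hLv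
  have hmem : ∀ t ∈ Ioo (-ρ) ρ, (t : ℂ) ∈ Metric.ball (0 : ℂ) ρ := fun t ht => by
    rw [mem_ball_zero_iff, Complex.norm_real, Real.norm_eq_abs, abs_lt]
    exact ht
  have hneg : ∀ t ∈ Ioo (-ρ) ρ, Φ (-t : ℂ) = -Φ t := fun t ht => by
    have h1 := hΦl _ (hmem t ht)
    have h2 := hΦl (-t : ℂ) (by simpa using hmem t ht)
    simp only [picard_neg] at h2
    exact tendsto_nhds_unique h2 h1.neg
  have hreal : ∀ t ∈ Ioo (-ρ) ρ, Φ t ∈ realPairs := fun t ht =>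
    isClosed_realPairs.mem_of_tendsto (hΦl _ (hmem t ht))
      (Eventually.of_forall fun n => picard_mem_realPairs hvr n t)
  have h0mem : (0 : ℝ) ∈ Ioo (-ρ) ρ := ⟨by linarith, hρ⟩
  have hΦ0 : Φ 0 = 0 := by
    have := hΦC 0 (by simpa using hρ)
    simpa using this
  refine ⟨ρ, hρ, fun t => (Real.pi + (Φ t).1.re, (Φ t).2.re), ?_, ?_, ?_, fun t ht => ?_,
    fun t ht => ?_⟩
  · have h1 : ContDiffOn ℝ ∞ Φ (Metric.ball 0 ρ) :=
      (hΦd.contDiffOn Metric.isOpen_ball).restrict_scalars ℝ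
    have h2 : ContDiffOn ℝ ∞ (fun t : ℝ => Φ t) (Ioo (-ρ) ρ) :=
      h1.comp Complex.ofRealCLM.contDiff.contDiffOn hmem
    exact (contDiffOn_const.add (Complex.reCLM.contDiff.comp_contDiffOn
      (contDiff_fst.comp_contDiffOn h2))).prodMk
      (Complex.reCLM.contDiff.comp_contDiffOn (contDiff_snd.comp_contDiffOn h2))
  · simp [hΦ0]
  -- The cubic estimate on `Φ t - t • v` identifies the derivative at `0` as `v`.
  · rw [hasDerivAt_iff_isLittleO]
    refine (Asymptotics.IsBigO.of_bound C (g := fun t : ℝ => t ^ 3) ?_).trans_isLittleO ?_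
    · filter_upwards [Ioo_mem_nhds h0mem.1 h0mem.2] with t ht
      have h := hΦC _ (hmem t ht)
      rw [Complex.norm_real] at h
      rw [norm_pow]
      refine le_trans (norm_prod_le_iff.2 ⟨?_, ?_⟩) h
      · refine le_trans (le_of_eq_of_le ?_ (Complex.abs_re_le_norm _)) (norm_fst_le (Φ t - (t : ℂ) • v))
        simp [hΦ0, hvd]
      · refine le_trans (le_of_eq_of_le ?_ (Complex.abs_re_le_norm _)) (norm_snd_le (Φ t - (t : ℂ) • v))
        simp [hΦ0, hvd]
    · simpa using Asymptotics.isLittleO_pow_id (𝕜 := ℝ) (n := 3) (by norm_num)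
  · have := hneg t ht
    simp only [Complex.ofReal_neg, this, rot]
    ext <;> simp
    ring
  · have e := hΦe _ (hmem t ht)
    have ht' : stableEig a * t ∈ Ioo (-ρ) ρ := by
      obtain ⟨t1, t2⟩ := ht
      constructor <;> nlinarith
    have w := eq_ofReal_of_mem_realPairs (hreal _ ht')
    have x := eq_ofReal_of_mem_realPairs (hreal t ht)
    rw [Complex.ofReal_mul] at w
    rw [w, x, sinRem_ofReal, linC_apply, linC_apply] at e
    obtain ⟨e1, e2⟩ := Prod.mk.inj e
    simp only [Complex.ofReal_mul]
    generalize (Φ (stableEig a * t)).1.re = w1 at *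
    generalize (Φ (stableEig a * t)).2.re = w2 at *
    generalize (Φ t).1.re = x1 at *
    generalize (Φ t).2.re = x2 at *
    dsimp only at e1 e2
    norm_cast at e1 e2
    have hs : Real.sin (Real.pi + x1) = -Real.sin x1 := by
      rw [add_comm, Real.sin_add_pi]
    -- The coefficients of `e1` and `e2` below are the rows of `M`, which undo the multiplication by
    -- `M⁻¹`.
    refine Prod.ext ?_ ?_
    · simp only [F, hs]
      linear_combination (1 - 2 * a) * e1 + a * e2 +
        (w1 + 2 * a * (Real.sin x1 - x1) - a * (Real.sin x2 - x2)) * hdD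
    · simp only [F, hs]
      linear_combination (-a) * e1 + (1 + 2 * a) * e2 +
        (w2 + a * (Real.sin x1 - x1) - 2 * a * (Real.sin x2 - x2)) * hdD

/-! ### The global stable curve -/

lemma exists_pow_mul_mem_Ioo {l ρ : ℝ} (hl0 : 0 < l) (hl1 : l < 1) (hρ : 0 < ρ) (t : ℝ) :
    ∃ n : ℕ, l ^ n * t ∈ Ioo (-ρ) ρ := by
  have h := (tendsto_pow_atTop_nhds_zero_of_lt_one hl0.le hl1).mul_const t
  rw [zero_mul] at h
  exact (h.eventually (Ioo_mem_nhds (by linarith : -ρ < 0) hρ)).exists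

/-- A smooth curve through the saddle, tangent to the stable direction, on which `F a` acts as the
multiplication of the parameter by the stable eigenvalue. -/
structure IsStableCurve (a : ℝ) (c : ℝ → ℝ × ℝ) : Prop where
  smooth : IsSmoothCurve c
  zero : c 0 = (Real.pi, 0)
  hasDerivAt : HasDerivAt c (2 + √3, 1) 0
  neg : ∀ t, c (-t) = rot (c t)
  map : ∀ t, F a (c t) = c (stableEig a * t)

/-- The global curve is `c t = F⁻ᵐ (φ (lᵐ t))` for any `m` that brings `lᵐ t` into the local
interval. Since `Fᵐ (c t) = c (lᵐ t)`, injectivity and nonvanishing of the derivative need only be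
known near `0`. -/
theorem exists_isStableCurve {a : ℝ} (ha0 : 0 < a) (ha1 : a < 1 / 6) :
    ∃ c : ℝ → ℝ × ℝ, IsStableCurve a c := by
  obtain ⟨ρ, hρ, φ, hφs, hφ0, hφd, hφr, hφF⟩ := exists_local_stable_curve ha0 ha1
  have hl0 := stableEig_pos ha0 ha1
  have hl1 := stableEig_lt_one ha0
  set l := stableEig a
  set G := (homeoF ha0 ha1).symm with hG
  have hGF : ∀ z, G (F a z) = z := (homeoF ha0 ha1).symm_apply_apply
  have hFG : ∀ z, F a (G z) = z := (homeoF ha0 ha1).apply_symm_apply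
  have hIoo : ∀ t ∈ Ioo (-ρ) ρ, l * t ∈ Ioo (-ρ) ρ := fun t ht => by
    obtain ⟨t1, t2⟩ := ht
    constructor <;> nlinarith
  have hIoon : ∀ (n : ℕ), ∀ t ∈ Ioo (-ρ) ρ, l ^ n * t ∈ Ioo (-ρ) ρ := fun n t ht => by
    induction n with
    | zero => simpa using ht
    | succ n ih => rw [pow_succ', mul_assoc]; exact hIoo _ ih
  have hiter : ∀ (k : ℕ), ∀ t ∈ Ioo (-ρ) ρ, G^[k] (φ (l ^ k * t)) = φ t := fun k t ht => by
    induction k with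
    | zero => simp
    | succ k ih =>
      rw [Function.iterate_succ_apply, pow_succ', mul_assoc, ← hφF _ (hIoon k t ht), hGF, ih]
  have hex := exists_pow_mul_mem_Ioo hl0 hl1 hρ
  choose n hn using hex
  -- The value does not depend on `m`. This lets one fixed `m` serve on a neighbourhood of `t`,
  -- which is what smoothness requires.
  have hcn : ∀ (m : ℕ) (t : ℝ), l ^ m * t ∈ Ioo (-ρ) ρ →
      G^[n t] (φ (l ^ n t * t)) = G^[m] (φ (l ^ m * t)) := by
    have key : ∀ (m k : ℕ) (t : ℝ), l ^ m * t ∈ Ioo (-ρ) ρ →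
        G^[m + k] (φ (l ^ (m + k) * t)) = G^[m] (φ (l ^ m * t)) := fun m k t h => by
      rw [Function.iterate_add_apply, pow_add, mul_comm (l ^ m), mul_assoc, hiter k _ h]
    intro m t h
    rw [← key m (n t) t h, ← key (n t) m t (hn t), add_comm]
  obtain ⟨c, hc⟩ : ∃ c : ℝ → ℝ × ℝ, ∀ (m : ℕ) (t : ℝ), l ^ m * t ∈ Ioo (-ρ) ρ →
      c t = G^[m] (φ (l ^ m * t)) := ⟨fun t => G^[n t] (φ (l ^ n t * t)), hcn⟩
  have hcφ : ∀ t ∈ Ioo (-ρ) ρ, c t = φ t := fun t ht => by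
    simpa using hc 0 t (by simpa using ht)
  have h0mem : (0 : ℝ) ∈ Ioo (-ρ) ρ := ⟨by linarith, hρ⟩
  have hcF : ∀ t, F a (c t) = c (l * t) := fun t => by
    have h1 := hc (n t + 1) t (by rw [pow_succ', mul_assoc]; exact hIoo _ (hn t))
    have h2 := hc (n t) (l * t) (by
      rw [← mul_assoc, mul_comm _ l, mul_assoc]; exact hIoo _ (hn t))
    rw [h1, h2, Function.iterate_succ_apply', hFG, pow_succ, mul_assoc]
  have hcFn : ∀ (m : ℕ) t, (F a)^[m] (c t) = c (l ^ m * t) := fun m t => by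
    induction m with
    | zero => simp
    | succ m ih => rw [Function.iterate_succ_apply', ih, hcF, pow_succ', mul_assoc]
  have hGs : ∀ m : ℕ, ContDiff ℝ ∞ G^[m] := fun m => by
    induction m with
    | zero => exact contDiff_id
    | succ m ih => exact ih.comp (contDiff_homeoF_symm ha0 ha1)
  have hcs : ContDiff ℝ ∞ c := by
    rw [contDiff_iff_contDiffAt]
    intro t
    have hev : ∀ᶠ s in 𝓝 t, l ^ n t * s ∈ Ioo (-ρ) ρ :=
      (continuous_const.mul continuous_id).continuousAt.eventually_mem
        (Ioo_mem_nhds (hn t).1 (hn t).2)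
    have h1 : ContDiffAt ℝ ∞ φ (l ^ n t * t) :=
      hφs.contDiffAt (Ioo_mem_nhds (hn t).1 (hn t).2)
    have h2 : ContDiffAt ℝ ∞ (fun s => G^[n t] (φ (l ^ n t * s))) t :=
      (hGs (n t)).contDiffAt.comp t (h1.comp t (contDiff_const.mul contDiff_id).contDiffAt)
    exact h2.congr_of_eventuallyEq (hev.mono fun s hs => hc _ _ hs)
  have hcd : HasDerivAt c (2 + √3, 1) 0 :=
    hφd.congr_of_eventuallyEq (eventually_of_mem (Ioo_mem_nhds h0mem.1 h0mem.2) hcφ)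
  have hv : ((2 + √3, 1) : ℝ × ℝ) ≠ 0 := fun h => one_ne_zero (congrArg Prod.snd h)
  have hto0 : ∀ t, Tendsto (fun m : ℕ => l ^ m * t) atTop (𝓝 0) := fun t => by
    simpa using (tendsto_pow_atTop_nhds_zero_of_lt_one hl0.le hl1).mul_const t
  refine ⟨c, ⟨hcs, ?_, ?_⟩, ?_, hcd, ?_, hcF⟩
  · have hstrict : HasStrictDerivAt (fun t => (c t).2) 1 0 := by
      have h := (contDiff_snd.comp hcs).contDiffAt.hasStrictDerivAt (x := (0 : ℝ)) (by simp)
      have e : deriv (Prod.snd ∘ c) 0 = 1 :=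
        (hasFDerivAt_snd.comp_hasDerivAt (0 : ℝ) hcd).deriv
      rwa [e] at h
    obtain ⟨s, hs, hinj⟩ : ∃ s ∈ 𝓝 (0 : ℝ), InjOn (fun t => (c t).2) s := by
      have h := hstrict.hasStrictFDerivAt_equiv one_ne_zero
      exact ⟨_, (h.toOpenPartialHomeomorph _).open_source.mem_nhds
        h.mem_toOpenPartialHomeomorph_source, (h.toOpenPartialHomeomorph _).injOn⟩
    intro t t' h
    obtain ⟨m, hm, hm'⟩ := (((hto0 t).eventually hs).and ((hto0 t').eventually hs)).exists
    have := hinj hm hm' (by simp only [← hcFn, h])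
    exact mul_left_cancel₀ (pow_pos hl0 m).ne' this
  · intro t ht
    have hcont : Continuous (deriv c) := hcs.continuous_deriv (by simp)
    have hne : ∀ᶠ s in 𝓝 (0 : ℝ), deriv c s ≠ 0 :=
      hcont.continuousAt.eventually_ne (by rw [hcd.deriv]; exact hv)
    have hdiff : ∀ s, HasDerivAt c (deriv c s) s := fun s =>
      (hcs.differentiable (by simp) s).hasDerivAt
    -- Differentiating `F ∘ c = c ∘ (l ·)` carries a zero of the derivative towards `0`, where the
    -- derivative is nonzero by continuity.
    have hzero : ∀ s, deriv c s = 0 → deriv c (l * s) = 0 := fun s hs => by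
      have h1 := (hasFDerivAt_F a (c s)).comp_hasDerivAt s (hdiff s)
      have h2 := HasDerivAt.scomp s (hdiff (l * s)) ((hasDerivAt_id s).const_mul l)
      have e : F a ∘ c = c ∘ fun s => l * id s := funext hcF
      rw [e] at h1
      have h3 := h2.unique h1
      rw [hs, map_zero, mul_one] at h3
      exact (smul_eq_zero.1 h3).resolve_left hl0.ne'
    have hzn : ∀ m : ℕ, deriv c (l ^ m * t) = 0 := fun m => by
      induction m with
      | zero => simpa using ht
      | succ m ih => rw [pow_succ', mul_assoc]; exact hzero _ ih
    obtain ⟨m, hm⟩ := ((hto0 t).eventually hne).exists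
    exact hm (hzn m)
  · rw [hcφ 0 h0mem, hφ0]
  · intro t
    have hinj : Function.Injective (F a)^[n t] := (F_injective ha0 ha1).iterate (n t)
    apply hinj
    have hr : (F a)^[n t] (rot (c t)) = rot ((F a)^[n t] (c t)) :=
      (Function.Commute.iterate_left (f := F a) (g := rot) (F_rot a) (n t)) (c t)
    rw [hr, hcFn, hcFn, mul_neg, hcφ _ (hn t), hcφ, hφr _ (hn t)]
    obtain ⟨h1, h2⟩ := hn t
    constructor <;> linarith

/-! ### The competitive order -/

/-- The order in diagonal coordinates whose positive cone is the fourth quadrant. -/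
def DiagLE (z w : ℝ × ℝ) : Prop := U z ≤ U w ∧ V w ≤ V z

lemma DiagLE.trans {z w y : ℝ × ℝ} (h : DiagLE z w) (h' : DiagLE w y) : DiagLE z y :=
  ⟨h.1.trans h'.1, h'.2.trans h.2⟩

lemma exists_comp_sub_eq (k u₁ v₁ u₂ v₂ : ℝ) : ∃ s ∈ Ioo (0 : ℝ) 1,
    comp k u₂ v₂ - comp k u₁ v₁ =
      (1 + k * (Real.cos (u₁ + s * (u₂ - u₁)) * Real.cos (v₁ + s * (v₂ - v₁)))) * (u₂ - u₁) +
      k * (Real.sin (u₁ + s * (u₂ - u₁)) * Real.sin (v₁ + s * (v₂ - v₁))) * (v₁ - v₂) := by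
  have hd : ∀ s : ℝ, HasDerivAt (fun s => comp k (u₁ + s * (u₂ - u₁)) (v₁ + s * (v₂ - v₁)))
      ((1 + k * (Real.cos (u₁ + s * (u₂ - u₁)) * Real.cos (v₁ + s * (v₂ - v₁)))) * (u₂ - u₁) +
      k * (Real.sin (u₁ + s * (u₂ - u₁)) * Real.sin (v₁ + s * (v₂ - v₁))) * (v₁ - v₂)) s := by
    intro s
    have h1 : HasDerivAt (fun s => u₁ + s * (u₂ - u₁)) (u₂ - u₁) s := by
      simpa using ((hasDerivAt_id s).mul_const (u₂ - u₁)).const_add u₁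
    have h2 : HasDerivAt (fun s => v₁ + s * (v₂ - v₁)) (v₂ - v₁) s := by
      simpa using ((hasDerivAt_id s).mul_const (v₂ - v₁)).const_add v₁
    exact (h1.add ((h1.sin.mul h2.cos).const_mul k)).congr_deriv (by ring)
  obtain ⟨s, hs, h⟩ := exists_hasDerivAt_eq_slope _ _ (zero_lt_one' ℝ)
    (fun s _ => (hd s).continuousAt.continuousWithinAt) (fun s _ => hd s)
  refine ⟨s, hs, ?_⟩
  rw [h]
  simp

lemma segment_bounds {l r x y s : ℝ} (hx : l ≤ x ∧ x ≤ r) (hy : l ≤ y ∧ y ≤ r)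
    (hs : s ∈ Ioo (0 : ℝ) 1) : l ≤ x + s * (y - x) ∧ x + s * (y - x) ≤ r := by
  obtain ⟨h0, h1⟩ := hs
  constructor <;> nlinarith

/-- On the square the partial derivatives `1 + k cos u cos v` and `-k sin u sin v` have constant
signs; the mean value theorem along the segment concludes. -/
lemma comp_le_comp {k u₁ v₁ u₂ v₂ : ℝ} (hk0 : 0 ≤ k) (hk1 : k ≤ 1)
    (hu₁ : 0 ≤ u₁ ∧ u₁ ≤ Real.pi) (hu₂ : 0 ≤ u₂ ∧ u₂ ≤ Real.pi)
    (hv₁ : 0 ≤ v₁ ∧ v₁ ≤ Real.pi) (hv₂ : 0 ≤ v₂ ∧ v₂ ≤ Real.pi)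
    (hu : u₁ ≤ u₂) (hv : v₂ ≤ v₁) : comp k u₁ v₁ ≤ comp k u₂ v₂ := by
  obtain ⟨s, hs, h⟩ := exists_comp_sub_eq k u₁ v₁ u₂ v₂
  have b1 := segment_bounds hu₁ hu₂ hs
  have b2 := segment_bounds hv₁ hv₂ hs
  have s1 := Real.sin_nonneg_of_nonneg_of_le_pi b1.1 b1.2
  have s2 := Real.sin_nonneg_of_nonneg_of_le_pi b2.1 b2.2
  have c : |Real.cos (u₁ + s * (u₂ - u₁)) * Real.cos (v₁ + s * (v₂ - v₁))| ≤ 1 := by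
    rw [abs_mul]
    exact mul_le_one₀ (Real.abs_cos_le_one _) (abs_nonneg _) (Real.abs_cos_le_one _)
  have c1 := (abs_le.1 c).1
  have e1 : 0 ≤ 1 + k * (Real.cos (u₁ + s * (u₂ - u₁)) * Real.cos (v₁ + s * (v₂ - v₁))) := by
    nlinarith
  have e2 := mul_nonneg e1 (sub_nonneg.2 hu)
  have e3 := mul_nonneg (mul_nonneg hk0 (mul_nonneg s1 s2)) (sub_nonneg.2 hv)
  linarith

lemma DiagLE.map_F {a : ℝ} (ha0 : 0 < a) (ha1 : a < 1 / 6) {z w : ℝ × ℝ} (hz : z ∈ S10)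
    (hw : w ∈ S10) (h : DiagLE z w) : DiagLE (F a z) (F a w) := by
  rw [mem_S10] at hz hw
  rw [DiagLE, U_F, U_F, V_F, V_F]
  exact ⟨comp_le_comp (by linarith) (by linarith) hz.1 hw.1 hz.2 hw.2 h.1 h.2,
    comp_le_comp (by linarith) (by linarith) hw.2 hz.2 hw.1 hz.1 h.2 h.1⟩

lemma abs_cos_le_half {x : ℝ} (h1 : Real.pi / 3 ≤ x) (h2 : x ≤ 2 * Real.pi / 3) :
    |Real.cos x| ≤ 1 / 2 := by
  have hpi := Real.pi_pos
  rw [abs_le]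
  constructor
  · have := Real.cos_le_cos_of_nonneg_of_le_pi (by linarith) (by linarith)
      (show Real.pi / 3 ≤ Real.pi - x by linarith)
    rw [Real.cos_pi_div_three, Real.cos_pi_sub] at this
    linarith
  · have := Real.cos_le_cos_of_nonneg_of_le_pi (by linarith) (by linarith) h1
    rwa [Real.cos_pi_div_three] at this

lemma cos_sin_bounds {x y : ℝ} (hx : Real.pi / 3 ≤ x ∧ x ≤ 2 * Real.pi / 3)
    (hy : Real.pi / 3 ≤ y ∧ y ≤ 2 * Real.pi / 3) :
    -(1 / 4) ≤ Real.cos x * Real.cos y ∧ 3 / 4 ≤ Real.sin x * Real.sin y := by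
  have hpi := Real.pi_pos
  have cx := abs_cos_le_half hx.1 hx.2
  have cy := abs_cos_le_half hy.1 hy.2
  have sx := Real.sin_nonneg_of_nonneg_of_le_pi (x := x) (by linarith [hx.1]) (by linarith [hx.2])
  have sy := Real.sin_nonneg_of_nonneg_of_le_pi (x := y) (by linarith [hy.1]) (by linarith [hy.2])
  constructor
  · have : |Real.cos x * Real.cos y| ≤ 1 / 2 * (1 / 2) := by
      rw [abs_mul]; gcongr
    linarith [(abs_le.1 this).1]
  · have key : ∀ t : ℝ, |Real.cos t| ≤ 1 / 2 → 3 / 4 ≤ Real.sin t ^ 2 := fun t ht => by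
      rw [Real.sin_sq]
      have : Real.cos t ^ 2 ≤ (1 / 2) ^ 2 := sq_le_sq' (abs_le.1 ht).1 (abs_le.1 ht).2
      linarith
    have h1 := key x cx
    have h2 := key y cy
    refine le_of_sq_le_sq ?_ (mul_nonneg sx sy)
    rw [mul_pow]
    nlinarith

/-- By the mean value form, the gain is `a(3p + q')` times the difference in `U` plus `a(3q + p')`
times that in `V`, with `p, p'` products of cosines and `q, q'` products of sines. The box is chosen
so that `p, p' ≥ -1/4` and `q, q' ≥ 3/4`, which just makes the first coefficient nonnegative. -/
lemma DiagLE.sub_le_map_F {a : ℝ} (ha0 : 0 < a) {z w : ℝ × ℝ}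
    (hzu : Real.pi / 3 ≤ U z ∧ U z ≤ 2 * Real.pi / 3)
    (hzv : Real.pi / 3 ≤ V z ∧ V z ≤ 2 * Real.pi / 3)
    (hwu : Real.pi / 3 ≤ U w ∧ U w ≤ 2 * Real.pi / 3)
    (hwv : Real.pi / 3 ≤ V w ∧ V w ≤ 2 * Real.pi / 3) (h : DiagLE z w) :
    (U w - U z) + (V z - V w) ≤ (U (F a w) - U (F a z)) + (V (F a z) - V (F a w)) := by
  rw [U_F, U_F, V_F, V_F]
  obtain ⟨s, hs, e1⟩ := exists_comp_sub_eq (3 * a) (U z) (V z) (U w) (V w)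
  obtain ⟨r, hr, e2⟩ := exists_comp_sub_eq a (V w) (U w) (V z) (U z)
  obtain ⟨c1, s1⟩ := cos_sin_bounds (segment_bounds hzu hwu hs) (segment_bounds hzv hwv hs)
  obtain ⟨c2, s2⟩ := cos_sin_bounds (segment_bounds hwv hzv hr) (segment_bounds hwu hzu hr)
  rw [e1, e2]
  generalize Real.cos (U z + s * (U w - U z)) * Real.cos (V z + s * (V w - V z)) = p at *
  generalize Real.sin (U z + s * (U w - U z)) * Real.sin (V z + s * (V w - V z)) = q at *
  generalize Real.cos (V w + r * (V z - V w)) * Real.cos (U w + r * (U z - U w)) = p' at *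
  generalize Real.sin (V w + r * (V z - V w)) * Real.sin (U w + r * (U z - U w)) = q' at *
  have hu := sub_nonneg.2 h.1
  have hv := sub_nonneg.2 h.2
  have f1 : 0 ≤ a * (3 * p + q') * (U w - U z) :=
    mul_nonneg (mul_nonneg ha0.le (by linarith)) hu
  have f2 : 0 ≤ a * (3 * q + p') * (V z - V w) :=
    mul_nonneg (mul_nonneg ha0.le (by linarith)) hv
  linarith

/-- The points whose forward orbit tends to the saddle. -/
def attracted (a : ℝ) : Set (ℝ × ℝ) :=
  {z | Tendsto (fun n : ℕ => (F a)^[n] z) atTop (𝓝 (Real.pi, 0))}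

lemma iterate_F_mem_S10 {a : ℝ} (ha0 : 0 < a) (ha1 : a < 1 / 6) {z : ℝ × ℝ} (n : ℕ) :
    (F a)^[n] z ∈ S10 ↔ z ∈ S10 := by
  induction n with
  | zero => rfl
  | succ n ih => rw [Function.iterate_succ_apply', F_mem_S10_iff ha0 ha1, ih]

lemma attracted_subset_S10 {a : ℝ} (ha0 : 0 < a) (ha1 : a < 1 / 6) : attracted a ⊆ S10 := by
  intro z hz
  have hpi := Real.pi_pos
  have hnhds : S10 ∈ 𝓝 ((Real.pi, 0) : ℝ × ℝ) := by
    rw [← mem_interior_iff_mem_nhds, mem_interior_S10, U_saddle, V_saddle]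
    constructor <;> constructor <;> linarith
  obtain ⟨n, hn⟩ := (hz.eventually hnhds).exists
  exact (iterate_F_mem_S10 ha0 ha1 n).1 hn

lemma mem_attracted_of_F {a : ℝ} {z : ℝ × ℝ} (h : F a z ∈ attracted a) : z ∈ attracted a := by
  refine (tendsto_add_atTop_iff_nat 1).1 ?_
  simpa only [Function.iterate_succ_apply] using (show Tendsto _ _ _ from h)

/-- Comparable points in the basin of the saddle coincide. -/
theorem eq_of_diagLE {a : ℝ} (ha0 : 0 < a) (ha1 : a < 1 / 6) {z w : ℝ × ℝ}
    (hz : z ∈ attracted a) (hw : w ∈ attracted a) (h : DiagLE z w) : z = w := by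
  have hpi := Real.pi_pos
  have hzS := attracted_subset_S10 ha0 ha1 hz
  have hwS := attracted_subset_S10 ha0 ha1 hw
  have hle : ∀ n : ℕ, DiagLE ((F a)^[n] z) ((F a)^[n] w) := fun n => by
    induction n with
    | zero => exact h
    | succ n ih =>
      rw [Function.iterate_succ_apply', Function.iterate_succ_apply']
      exact ih.map_F ha0 ha1 ((iterate_F_mem_S10 ha0 ha1 n).2 hzS)
        ((iterate_F_mem_S10 ha0 ha1 n).2 hwS)
  have hU : ∀ {y}, y ∈ attracted a →
      Tendsto (fun n : ℕ => U ((F a)^[n] y)) atTop (𝓝 (Real.pi / 2)) := fun hy => by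
    rw [← U_saddle]; exact (continuous_U.tendsto _).comp hy
  have hV : ∀ {y}, y ∈ attracted a →
      Tendsto (fun n : ℕ => V ((F a)^[n] y)) atTop (𝓝 (Real.pi / 2)) := fun hy => by
    rw [← V_saddle]; exact (continuous_V.tendsto _).comp hy
  have hnb : Icc (Real.pi / 3) (2 * Real.pi / 3) ∈ 𝓝 (Real.pi / 2) :=
    Icc_mem_nhds (by linarith) (by linarith)
  obtain ⟨m, hm⟩ := eventually_atTop.1 ((((hU hz).eventually hnb).and ((hV hz).eventually hnb)).and
    (((hU hw).eventually hnb).and ((hV hw).eventually hnb)))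
  obtain ⟨D, hD⟩ : ∃ D : ℕ → ℝ, ∀ n, D n = (U ((F a)^[n] w) - U ((F a)^[n] z)) +
    (V ((F a)^[n] z) - V ((F a)^[n] w)) := ⟨_, fun _ => rfl⟩
  -- From time `m` on both orbits stay in the box, so the ordered distance `D` is nondecreasing. It
  -- also tends to `0`, hence is zero at time `m`, and injectivity of `F` brings the equality back
  -- to time `0`.
  have hmono : ∀ k, D m ≤ D (m + k) := fun k => by
    induction k with
    | zero => exact le_rfl
    | succ k ih =>
      obtain ⟨⟨h1, h2⟩, h3, h4⟩ := hm (m + k) (by omega)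
      refine ih.trans ?_
      rw [← add_assoc, hD, hD, Function.iterate_succ_apply', Function.iterate_succ_apply']
      exact (hle (m + k)).sub_le_map_F ha0 h1 h2 h3 h4
  have hlim : Tendsto D atTop (𝓝 0) := by
    have := ((hU hw).sub (hU hz)).add ((hV hz).sub (hV hw))
    simp only [sub_self, add_zero] at this
    exact this.congr fun n => (hD n).symm
  have hD0 : D m ≤ 0 := by
    refine ge_of_tendsto hlim (eventually_atTop.2 ⟨m, fun n hn => ?_⟩)
    obtain ⟨k, rfl⟩ := Nat.exists_eq_add_of_le hn
    exact hmono k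
  rw [hD] at hD0
  obtain ⟨h1, h2⟩ := hle m
  have : (F a)^[m] z = (F a)^[m] w := ext_diag (by linarith) (by linarith)
  exact (F_injective ha0 ha1).iterate m this

lemma stableManifold_eq_attracted (a : ℝ) {W : Set (ℝ × ℝ)}
    (hW : W ∈ 𝓝 ((Real.pi, 0) : ℝ × ℝ)) :
    stableManifold (F a) (Real.pi, 0) W = attracted a := by
  ext z
  simp only [stableManifold, mem_iUnion, mem_preimage, localStableManifold, attracted]
  have hshift : ∀ n : ℕ, (fun k : ℕ => (F a)^[k] ((F a)^[n] z)) = fun k => (F a)^[k + n] z :=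
    fun n => funext fun k => (Function.iterate_add_apply _ _ _ _).symm
  constructor
  · rintro ⟨n, -, hn⟩
    rw [hshift n] at hn
    exact (tendsto_add_atTop_iff_nat n).1 hn
  · intro h
    obtain ⟨n, hn⟩ := eventually_atTop.1 ((show Tendsto _ _ _ from h).eventually hW)
    refine ⟨n, fun k => ?_, ?_⟩
    · rw [← Function.iterate_add_apply]
      exact hn _ (by omega)
    · rw [hshift n]
      exact (tendsto_add_atTop_iff_nat n).2 h

/-! ### Geometry of the stable curve -/

lemma fst_eq (z : ℝ × ℝ) : z.1 = U z + V z := by simp [U, V]; ring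

lemma snd_eq (z : ℝ × ℝ) : z.2 = U z - V z := by simp [U, V]; ring

lemma diagLE_of_fst_eq {z w : ℝ × ℝ} (h1 : z.1 = w.1) (h2 : z.2 ≤ w.2) : DiagLE z w := by
  simp only [DiagLE, U, V]
  constructor <;> linarith

lemma continuous_rot : Continuous rot := by unfold rot; fun_prop

lemma rot_zero : rot (0, 0) = (2 * Real.pi, 0) := by simp [rot]

lemma fst_mem_Ioo_of_mem_S10 {z : ℝ × ℝ} (hz : z ∈ S10) (h0 : z ≠ (0, 0))
    (h1 : z ≠ (2 * Real.pi, 0)) : z.1 ∈ Ioo 0 (2 * Real.pi) := by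
  obtain ⟨⟨u0, u1⟩, v0, v1⟩ := mem_S10.1 hz
  have e1 := fst_eq z
  have e2 := snd_eq z
  constructor <;> by_contra! h
  · exact h0 (Prod.ext (by simp; linarith) (by simp; linarith))
  · exact h1 (Prod.ext (by simp; linarith) (by simp; linarith))

/-- A fixed point has `sin U cos V = 0 = sin V cos U`, and both cosines are positive in this range.
It identifies the endpoint of the stable curve. -/
lemma eq_zero_of_F_eq_self {a : ℝ} (ha0 : 0 < a) {z : ℝ × ℝ} (hz : F a z = z)
    (hu : 0 ≤ U z ∧ U z < Real.pi / 2) (hv : 0 ≤ V z ∧ V z < Real.pi / 2) : z = (0, 0) := by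
  have hpi := Real.pi_pos
  have key : ∀ {k x y : ℝ}, 0 < k → comp k x y = x → 0 ≤ x ∧ x < Real.pi / 2 →
      0 ≤ y ∧ y < Real.pi / 2 → x = 0 := by
    intro k x y hk h hx hy
    have hc : 0 < Real.cos y := Real.cos_pos_of_mem_Ioo ⟨by linarith [hy.1], hy.2⟩
    unfold comp at h
    by_contra hne
    have hs : 0 < Real.sin x :=
      Real.sin_pos_of_pos_of_lt_pi (lt_of_le_of_ne hx.1 (Ne.symm hne)) (by linarith [hx.2])
    have : 0 < k * (Real.sin x * Real.cos y) := by positivity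
    linarith
  have h1 : U z = 0 := key (k := 3 * a) (by positivity) (by rw [← U_F, hz]) hu hv
  have h2 : V z = 0 := key ha0 (by rw [← V_F, hz]) hv hu
  exact ext_diag (by rw [h1]; simp [U]) (by rw [h2]; simp [V])

namespace IsStableCurve

variable {a : ℝ} {c : ℝ → ℝ × ℝ}

lemma continuous (hc : IsStableCurve a c) : Continuous c := hc.smooth.1.continuous

lemma iterate_map (hc : IsStableCurve a c) (n : ℕ) (t : ℝ) :
    (F a)^[n] (c t) = c (stableEig a ^ n * t) := by
  induction n with
  | zero => simp
  | succ n ih => rw [Function.iterate_succ_apply', ih, hc.map, pow_succ', mul_assoc]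

lemma mem_attracted (hc : IsStableCurve a c) (ha0 : 0 < a) (ha1 : a < 1 / 6) (t : ℝ) :
    c t ∈ attracted a := by
  have h := ((tendsto_pow_atTop_nhds_zero_of_lt_one (stableEig_pos ha0 ha1).le
    (stableEig_lt_one ha0)).mul_const t)
  rw [zero_mul] at h
  have h2 := (hc.continuous.tendsto 0).comp h
  rw [hc.zero] at h2
  exact h2.congr fun n => (hc.iterate_map n t).symm

/-- Two points of the curve with equal `U` are comparable, hence equal. A continuous injective
function is strictly monotone, and the derivative at the saddle decides the direction. -/
lemma strictMono_U (hc : IsStableCurve a c) (ha0 : 0 < a) (ha1 : a < 1 / 6) :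
    StrictMono fun t => U (c t) := by
  have hinj : Function.Injective fun t => U (c t) := fun s t h => by
    apply hc.smooth.2.1
    rcases le_total (V (c s)) (V (c t)) with h' | h'
    · exact (eq_of_diagLE ha0 ha1 (hc.mem_attracted ha0 ha1 t) (hc.mem_attracted ha0 ha1 s)
        ⟨h.ge, h'⟩).symm
    · exact eq_of_diagLE ha0 ha1 (hc.mem_attracted ha0 ha1 s) (hc.mem_attracted ha0 ha1 t)
        ⟨h.le, h'⟩
  refine ((continuous_U.comp hc.continuous).strictMono_of_inj hinj).resolve_right fun hanti => ?_
  have hd : HasDerivAt (fun t => U (c t)) ((2 + √3 + 1) / 2) 0 :=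
    ((hasFDerivAt_fst.comp_hasDerivAt (0 : ℝ) hc.hasDerivAt).add
      (hasFDerivAt_snd.comp_hasDerivAt (0 : ℝ) hc.hasDerivAt)).div_const 2
  have h1 : deriv (fun t => U (c t)) 0 ≤ 0 := hanti.antitone.deriv_nonpos
  rw [hd.deriv] at h1
  linarith [Real.sqrt_nonneg 3]

lemma strictMono_V (hc : IsStableCurve a c) (ha0 : 0 < a) (ha1 : a < 1 / 6) :
    StrictMono fun t => V (c t) := fun s t hst => by
  by_contra! h
  exact hst.ne (hc.smooth.2.1 (eq_of_diagLE ha0 ha1 (hc.mem_attracted ha0 ha1 s)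
    (hc.mem_attracted ha0 ha1 t) ⟨(hc.strictMono_U ha0 ha1 hst).le, h⟩))

lemma mem_interior_s1 (hc : IsStableCurve a c) (ha0 : 0 < a) (ha1 : a < 1 / 6) {t : ℝ}
    (ht : t < 0) : c t ∈ interior s1 := by
  have hS := mem_S10.1 (attracted_subset_S10 ha0 ha1 (hc.mem_attracted ha0 ha1 (t - 1)))
  have u0 := hc.strictMono_U ha0 ha1 (sub_one_lt t)
  have v0 := hc.strictMono_V ha0 ha1 (sub_one_lt t)
  have u1 := hc.strictMono_U ha0 ha1 ht
  have v1 := hc.strictMono_V ha0 ha1 ht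
  simp only [hc.zero, U_saddle, V_saddle] at u0 v0 u1 v1
  exact AlignedClocks.mem_interior_s1.2
    ⟨⟨by linarith [hS.1.1], u1⟩, by linarith [hS.2.1], v1⟩

lemma mem_interior_s4 (hc : IsStableCurve a c) (ha0 : 0 < a) (ha1 : a < 1 / 6) {t : ℝ}
    (ht : 0 < t) : c t ∈ interior s4 := by
  have h := AlignedClocks.mem_interior_s1.1 (hc.mem_interior_s1 ha0 ha1 (neg_lt_zero.2 ht))
  rw [hc.neg, U_rot, V_rot] at h
  obtain ⟨⟨h1, h2⟩, h3, h4⟩ := h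
  exact AlignedClocks.mem_interior_s4.2
    ⟨⟨by linarith, by linarith⟩, by linarith, by linarith⟩

lemma mem_interior_S10 (hc : IsStableCurve a c) (ha0 : 0 < a) (ha1 : a < 1 / 6) (t : ℝ) :
    c t ∈ interior S10 := by
  have h1 := mem_S10.1 (attracted_subset_S10 ha0 ha1 (hc.mem_attracted ha0 ha1 (t - 1)))
  have h2 := mem_S10.1 (attracted_subset_S10 ha0 ha1 (hc.mem_attracted ha0 ha1 (t + 1)))
  have u0 := hc.strictMono_U ha0 ha1 (sub_one_lt t)
  have v0 := hc.strictMono_V ha0 ha1 (sub_one_lt t)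
  have u1 := hc.strictMono_U ha0 ha1 (lt_add_one t)
  have v1 := hc.strictMono_V ha0 ha1 (lt_add_one t)
  exact AlignedClocks.mem_interior_S10.2
    ⟨⟨h1.1.1.trans_lt u0, u1.trans_le h2.1.2⟩, h1.2.1.trans_lt v0, v1.trans_le h2.2.2⟩

/-- Monotonicity and boundedness of `U` and `V` along the curve give a limit. The relation `F (c t)
= c (l t)` makes it a fixed point, and it lies in `[0, π/2)²`. -/
lemma tendsto_atBot (hc : IsStableCurve a c) (ha0 : 0 < a) (ha1 : a < 1 / 6) :
    Tendsto c atBot (𝓝 (0, 0)) := by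
  have hS : ∀ t, c t ∈ S10 := fun t => attracted_subset_S10 ha0 ha1 (hc.mem_attracted ha0 ha1 t)
  have bU : BddBelow (range fun t => U (c t)) :=
    ⟨0, by rintro _ ⟨t, rfl⟩; exact (mem_S10.1 (hS t)).1.1⟩
  have bV : BddBelow (range fun t => V (c t)) :=
    ⟨0, by rintro _ ⟨t, rfl⟩; exact (mem_S10.1 (hS t)).2.1⟩
  have hU := tendsto_atBot_ciInf (hc.strictMono_U ha0 ha1).monotone bU
  have hV := tendsto_atBot_ciInf (hc.strictMono_V ha0 ha1).monotone bV
  have hlim := (diagHomeo.symm.continuous.tendsto _).comp (hU.prodMk_nhds hV)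
  set z := diagHomeo.symm (⨅ t, U (c t), ⨅ t, V (c t)) with hz
  have hcz : Tendsto c atBot (𝓝 z) := hlim.congr fun t => diagHomeo.symm_apply_apply (c t)
  have hdz : (U z, V z) = (⨅ t, U (c t), ⨅ t, V (c t)) := diagHomeo.apply_symm_apply _
  obtain ⟨e1, e2⟩ := Prod.mk.inj hdz
  have hl : Tendsto (fun t => stableEig a * t) atBot atBot :=
    tendsto_id.const_mul_atBot (stableEig_pos ha0 ha1)
  have hfix : F a z = z :=
    tendsto_nhds_unique (((continuous_F a).tendsto z).comp hcz)
      ((hcz.comp hl).congr fun t => (hc.map t).symm)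
  have h1 := AlignedClocks.mem_interior_s1.1
    (hc.mem_interior_s1 ha0 ha1 (t := -1) (by norm_num))
  have hz0 : z = (0, 0) := by
    refine eq_zero_of_F_eq_self ha0 hfix ⟨?_, ?_⟩ ⟨?_, ?_⟩
    · rw [e1]; exact le_ciInf fun t => (mem_S10.1 (hS t)).1.1
    · rw [e1]; exact (ciInf_le bU (-1)).trans_lt h1.1.2
    · rw [e2]; exact le_ciInf fun t => (mem_S10.1 (hS t)).2.1
    · rw [e2]; exact (ciInf_le bV (-1)).trans_lt h1.2.2
  rwa [hz0] at hcz

lemma tendsto_atTop (hc : IsStableCurve a c) (ha0 : 0 < a) (ha1 : a < 1 / 6) :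
    Tendsto c atTop (𝓝 (2 * Real.pi, 0)) := by
  have h := (continuous_rot.tendsto _).comp ((hc.tendsto_atBot ha0 ha1).comp tendsto_neg_atTop_atBot)
  rw [rot_zero] at h
  exact h.congr fun t => by simp [hc.neg, rot_rot]

lemma fst_mem_Ioo (hc : IsStableCurve a c) (ha0 : 0 < a) (ha1 : a < 1 / 6) (t : ℝ) :
    (c t).1 ∈ Ioo 0 (2 * Real.pi) := by
  obtain ⟨⟨h1, h2⟩, h3, h4⟩ := AlignedClocks.mem_interior_S10.1 (hc.mem_interior_S10 ha0 ha1 t)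
  rw [fst_eq]
  constructor <;> linarith

lemma exists_fst_eq (hc : IsStableCurve a c) (ha0 : 0 < a) (ha1 : a < 1 / 6) {x : ℝ}
    (hx : x ∈ Ioo 0 (2 * Real.pi)) : ∃ t, (c t).1 = x := by
  have h1 : ∀ᶠ t in atBot, (c t).1 < x :=
    ((continuous_fst.tendsto _).comp (hc.tendsto_atBot ha0 ha1)).eventually (gt_mem_nhds hx.1)
  have h2 : ∀ᶠ t in atTop, x < (c t).1 :=
    ((continuous_fst.tendsto _).comp (hc.tendsto_atTop ha0 ha1)).eventually (lt_mem_nhds hx.2)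
  obtain ⟨t1, h1⟩ := h1.exists
  obtain ⟨t2, h2⟩ := h2.exists
  exact mem_range_of_exists_le_of_exists_ge (continuous_fst.comp hc.continuous)
    ⟨t1, h1.le⟩ ⟨t2, h2.le⟩

lemma range_eq (hc : IsStableCurve a c) (ha0 : 0 < a) (ha1 : a < 1 / 6) :
    range c = attracted a := by
  refine Subset.antisymm (range_subset_iff.2 (hc.mem_attracted ha0 ha1)) fun z hz => ?_
  have hfix : ∀ p : ℝ × ℝ, F a p = p → p ≠ (Real.pi, 0) → z ≠ p := by
    rintro p hp hne rfl
    refine hne (tendsto_nhds_unique ?_ (show Tendsto _ _ _ from hz))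
    simp only [Function.iterate_fixed hp]
    exact tendsto_const_nhds
  have hpi := Real.pi_pos
  have hx := fst_mem_Ioo_of_mem_S10 (attracted_subset_S10 ha0 ha1 hz)
    (hfix _ (F_zero a) fun h => by have := congrArg Prod.fst h; simp at this; linarith)
    (hfix _ (F_two_pi a) fun h => by have := congrArg Prod.fst h; simp at this)
  obtain ⟨t, ht⟩ := hc.exists_fst_eq ha0 ha1 hx
  refine ⟨t, ?_⟩
  have hct := hc.mem_attracted ha0 ha1 t
  rcases le_total (c t).2 z.2 with h | h
  · exact eq_of_diagLE ha0 ha1 hct hz (diagLE_of_fst_eq ht h)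
  · exact (eq_of_diagLE ha0 ha1 hz hct (diagLE_of_fst_eq ht.symm h)).symm

/-- `U` and `V` increase together along the curve, so `|ΔU - ΔV| ≤ ΔU + ΔV`: the curve is a
1-Lipschitz graph. -/
lemma abs_snd_sub_le (hc : IsStableCurve a c) (ha0 : 0 < a) (ha1 : a < 1 / 6) (s t : ℝ) :
    |(c s).2 - (c t).2| ≤ |(c s).1 - (c t).1| := by
  wlog h : s ≤ t generalizing s t
  · rw [abs_sub_comm, abs_sub_comm (c s).1]
    exact this t s (le_of_not_ge h)
  have hU : U (c s) ≤ U (c t) := (hc.strictMono_U ha0 ha1).monotone h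
  have hV : V (c s) ≤ V (c t) := (hc.strictMono_V ha0 ha1).monotone h
  rw [fst_eq, fst_eq, snd_eq, snd_eq, abs_sub_comm (U (c s) + _), abs_le,
    abs_of_nonneg (by linarith)]
  constructor <;> linarith

end IsStableCurve

/-! ### Heteroclinic curves and closures -/

lemma isHeteroclinicCurve_image_Iio {f : ℝ × ℝ → ℝ × ℝ} {c : ℝ → ℝ × ℝ} {l : ℝ} {p q : ℝ × ℝ}
    (hl0 : 0 < l) (hl1 : l < 1) (hc : IsSmoothCurve c) (hq : c 0 = q)
    (hf : ∀ t, f (c t) = c (l * t)) (hp : Tendsto c atBot (𝓝 p)) (hfp : f p = p) (hpq : p ≠ q) :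
    IsHeteroclinicCurve f p q (c '' Iio 0) := by
  have hc0 : Tendsto c (𝓝 0) (𝓝 q) := hq ▸ hc.1.continuous.tendsto 0
  -- The substitution `-exp (-t)` is an increasing diffeomorphism from the line onto `(-∞, 0)`.
  refine ⟨hpq, hfp, by rw [← hq, hf, mul_zero], ⟨fun t => c (-Real.exp (-t)), ⟨?_, ?_, ?_⟩, ?_, ?_,
    ?_⟩, ?_, ?_⟩
  · exact hc.1.comp (Real.contDiff_exp.comp contDiff_neg).neg
  · intro s t h
    have := hc.2.1 h
    simpa using this
  · intro t
    have h1 : HasDerivAt (fun t : ℝ => -Real.exp (-t)) (Real.exp (-t)) t :=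
      ((hasDerivAt_neg t).exp.fun_neg).congr_deriv (by ring)
    have h2 := HasDerivAt.scomp t
      (hc.1.differentiable (by simp) (-Real.exp (-t))).hasDerivAt h1
    have h3 : deriv (fun t => c (-Real.exp (-t))) t =
        Real.exp (-t) • deriv c (-Real.exp (-t)) := h2.deriv
    rw [h3]
    exact smul_ne_zero (Real.exp_pos _).ne' (hc.2.2 _)
  · ext z
    constructor
    · rintro ⟨t, rfl⟩
      exact ⟨_, neg_lt_zero.2 (Real.exp_pos _), rfl⟩
    · rintro ⟨t, ht, rfl⟩
      refine ⟨-Real.log (-t), ?_⟩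
      simp only [neg_neg]
      rw [Real.exp_log (neg_pos.2 ht), neg_neg]
  · exact hp.comp (tendsto_neg_atTop_atBot.comp (Real.tendsto_exp_atTop.comp tendsto_neg_atBot_atTop))
  · refine hc0.comp ?_
    simpa using (Real.tendsto_exp_atBot.comp tendsto_neg_atTop_atBot).neg
  · ext z
    constructor
    · rintro ⟨_, ⟨t, ht, rfl⟩, rfl⟩
      exact ⟨l * t, mul_neg_of_pos_of_neg hl0 ht, (hf t).symm⟩
    · rintro ⟨t, ht, rfl⟩
      refine ⟨_, ⟨l⁻¹ * t, mul_neg_of_pos_of_neg (inv_pos.2 hl0) ht, rfl⟩, ?_⟩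
      rw [hf, mul_inv_cancel_left₀ hl0.ne']
  · rintro _ ⟨t, ht, rfl⟩
    refine ⟨fun n => c (l ^ n * t), by simp, fun n => ?_, ?_, ?_⟩
    · change c (l ^ (n + 1) * t) = f (c (l ^ n * t))
      rw [hf, zpow_add_one₀ hl0.ne', mul_comm (l ^ n), mul_assoc]
    · refine hp.comp ?_
      have h1 : Tendsto (fun n : ℤ => l ^ n) atBot atTop := by
        simpa [Function.comp_def] using
          (tendsto_rpow_atBot_of_base_lt_one l hl0 hl1).comp
            (tendsto_intCast_atBot_iff.2 (tendsto_id (α := ℤ)))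
      exact h1.atTop_mul_const_of_neg ht
    · refine hc0.comp ?_
      have h1 : Tendsto (fun n : ℤ => l ^ n) atTop (𝓝 0) := by
        simpa [Function.comp_def] using
          (tendsto_rpow_atTop_of_base_lt_one l (by linarith) hl1).comp
            (tendsto_intCast_atTop_atTop (R := ℝ))
      simpa using h1.mul_const t

lemma closure_range_of_tendsto {X : Type*} [TopologicalSpace X] [T2Space X] {c : ℝ → X} {p q : X}
    (hc : Continuous c) (hp : Tendsto c atBot (𝓝 p)) (hq : Tendsto c atTop (𝓝 q)) :
    closure (range c) = range c ∪ {p, q} := by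
  refine Subset.antisymm (closure_minimal subset_union_left ?_) ?_
  -- Composing with `|t|` folds the line, so each half of the curve has a single limit at infinity
  -- and becomes compact once that limit is added.
  · have habs : Tendsto (fun t : ℝ => |t|) (cocompact ℝ) atTop := tendsto_norm_cocompact_atTop
    have h1 := (hq.comp habs).isCompact_insert_range_of_cocompact (hc.comp continuous_abs)
    have h2 := ((hp.comp tendsto_neg_atTop_atBot).comp
      habs).isCompact_insert_range_of_cocompact ((hc.comp continuous_neg).comp continuous_abs)
    have e : range c ∪ {p, q} = insert q (range (c ∘ fun t => |t|)) ∪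
        insert p (range ((c ∘ fun t => -t) ∘ fun t => |t|)) := by
      ext z
      constructor
      · rintro (⟨t, rfl⟩ | rfl | rfl)
        · rcases le_total 0 t with h | h
          · exact Or.inl (Or.inr ⟨t, by simp [abs_of_nonneg h]⟩)
          · exact Or.inr (Or.inr ⟨t, by simp [abs_of_nonpos h]⟩)
        · exact Or.inr (Or.inl rfl)
        · exact Or.inl (Or.inl rfl)
      · rintro ((rfl | ⟨t, rfl⟩) | (rfl | ⟨t, rfl⟩))
        · exact Or.inr (Or.inr rfl)
        · exact Or.inl ⟨_, rfl⟩
        · exact Or.inr (Or.inl rfl)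
        · exact Or.inl ⟨_, rfl⟩
    rw [e]
    exact h1.isClosed.union h2.isClosed
  · refine union_subset subset_closure ?_
    rintro z (rfl | rfl)
    · exact mem_closure_of_tendsto hp (Eventually.of_forall mem_range_self)
    · exact mem_closure_of_tendsto hq (Eventually.of_forall mem_range_self)

/-! ### The splitting of the square -/

lemma rot_mem_S10_iff {z : ℝ × ℝ} : rot z ∈ S10 ↔ z ∈ S10 := by
  rw [mem_S10, mem_S10, U_rot, V_rot]
  constructor <;> rintro ⟨⟨h1, h2⟩, h3, h4⟩ <;> refine ⟨⟨?_, ?_⟩, ?_, ?_⟩ <;> linarith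

lemma rot_mem_interior_S10_iff {z : ℝ × ℝ} : rot z ∈ interior S10 ↔ z ∈ interior S10 := by
  rw [mem_interior_S10, mem_interior_S10, U_rot, V_rot]
  constructor <;> rintro ⟨⟨h1, h2⟩, h3, h4⟩ <;> refine ⟨⟨?_, ?_⟩, ?_, ?_⟩ <;> linarith

lemma below_eq_preimage_rot {η A : Set (ℝ × ℝ)} (hη : ∀ z, z ∈ η → rot z ∈ η)
    (hA : ∀ z, rot z ∈ A ↔ z ∈ A) : below η A = rot ⁻¹' above η A := by
  ext z
  constructor
  · rintro ⟨hz, w, hw, h1, h2⟩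
    refine ⟨(hA z).2 hz, rot w, hη w hw, ?_, ?_⟩ <;> simp [rot, h1, h2]
  · rintro ⟨hz, w, hw, h1, h2⟩
    refine ⟨(hA z).1 hz, rot w, hη w hw, ?_, ?_⟩
    · simp only [rot] at h1 ⊢; linarith
    · simp only [rot] at h2 ⊢; linarith

lemma image_rot (s : Set (ℝ × ℝ)) : rot '' s = rot ⁻¹' s :=
  congrFun (image_eq_preimage_of_inverse rot_rot rot_rot) s

/-- A preimage in `R` of a point of `P` cannot lie in `Q`, since `Q` is mapped into itself. -/
lemma image_eq_of_mapsTo_of_disjoint {α : Type*} {f : α → α} {P Q R : Set α} (hPQ : P ∪ Q = R)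
    (hd : Disjoint P Q) (hR : f '' R = R) (hP : MapsTo f P P) (hQ : MapsTo f Q Q) :
    f '' P = P := by
  refine Subset.antisymm hP.image_subset fun z hz => ?_
  obtain ⟨y, hy, rfl⟩ : z ∈ f '' R := by rw [hR, ← hPQ]; exact Or.inl hz
  rw [← hPQ] at hy
  rcases hy with hy | hy
  · exact ⟨y, hy, rfl⟩
  · exact (disjoint_left.1 hd hz (hQ hy)).elim

lemma F_mem_attracted_iff {a : ℝ} (z : ℝ × ℝ) : F a z ∈ attracted a ↔ z ∈ attracted a := by
  refine ⟨mem_attracted_of_F, fun h => ?_⟩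
  have := (tendsto_add_atTop_iff_nat 1).2 (show Tendsto _ _ _ from h)
  simpa only [Function.iterate_succ_apply] using! this

lemma F_eq_iff {a : ℝ} (ha0 : 0 < a) (ha1 : a < 1 / 6) {p : ℝ × ℝ} (hp : F a p = p)
    (z : ℝ × ℝ) : F a z = p ↔ z = p :=
  ⟨fun h => F_injective ha0 ha1 (h.trans hp.symm), fun h => h ▸ hp⟩

lemma disjoint_above_below {a : ℝ} (ha0 : 0 < a) (ha1 : a < 1 / 6) (A : Set (ℝ × ℝ)) :
    Disjoint (above (attracted a) A) (below (attracted a) A) := by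
  refine disjoint_left.2 ?_
  rintro z ⟨-, w, hw, h1, h2⟩ ⟨-, w', hw', h1', h2'⟩
  have := eq_of_diagLE ha0 ha1 hw hw' (diagLE_of_fst_eq (h1.trans h1'.symm) (by linarith))
  subst this
  linarith

namespace IsStableCurve

variable {a : ℝ} {c : ℝ → ℝ × ℝ}

lemma exists_mem_attracted_fst_eq (hc : IsStableCurve a c) (ha0 : 0 < a) (ha1 : a < 1 / 6)
    {x : ℝ} (hx : x ∈ Ioo 0 (2 * Real.pi)) : ∃ w ∈ attracted a, w.1 = x := by
  obtain ⟨t, ht⟩ := hc.exists_fst_eq ha0 ha1 hx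
  exact ⟨c t, hc.mem_attracted ha0 ha1 t, ht⟩

lemma fst_mem_Ioo_of_mem_attracted (hc : IsStableCurve a c) (ha0 : 0 < a) (ha1 : a < 1 / 6)
    {w : ℝ × ℝ} (hw : w ∈ attracted a) : w.1 ∈ Ioo 0 (2 * Real.pi) := by
  rw [← hc.range_eq ha0 ha1] at hw
  obtain ⟨t, rfl⟩ := hw
  exact hc.fst_mem_Ioo ha0 ha1 t

lemma rot_mem_attracted (hc : IsStableCurve a c) (ha0 : 0 < a) (ha1 : a < 1 / 6)
    (z : ℝ × ℝ) (hz : z ∈ attracted a) : rot z ∈ attracted a := by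
  rw [← hc.range_eq ha0 ha1] at hz
  obtain ⟨t, rfl⟩ := hz
  rw [← hc.neg]
  exact hc.mem_attracted ha0 ha1 _

lemma closure_attracted (hc : IsStableCurve a c) (ha0 : 0 < a) (ha1 : a < 1 / 6) :
    closure (attracted a) = attracted a ∪ {(0, 0), (2 * Real.pi, 0)} := by
  rw [← hc.range_eq ha0 ha1]
  exact closure_range_of_tendsto hc.continuous (hc.tendsto_atBot ha0 ha1)
    (hc.tendsto_atTop ha0 ha1)

lemma above_union_below (hc : IsStableCurve a c) (ha0 : 0 < a) (ha1 : a < 1 / 6)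
    {A : Set (ℝ × ℝ)} (hA : A ⊆ S10) :
    above (attracted a) A ∪ below (attracted a) A = A \ closure (attracted a) := by
  rw [hc.closure_attracted ha0 ha1]
  have hfst : ∀ {z w : ℝ × ℝ}, w ∈ attracted a → w.1 = z.1 → w.2 ≠ z.2 →
      z ∉ attracted a ∪ {(0, 0), (2 * Real.pi, 0)} := by
    intro z w hw h1 h2 hz
    have hx := hc.fst_mem_Ioo_of_mem_attracted ha0 ha1 hw
    rw [h1] at hx
    rcases hz with hz | rfl | rfl
    · rcases le_total w.2 z.2 with h | h
      · exact h2 (congrArg Prod.snd (eq_of_diagLE ha0 ha1 hw hz (diagLE_of_fst_eq h1 h)))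
      · exact h2 (congrArg Prod.snd
          (eq_of_diagLE ha0 ha1 hz hw (diagLE_of_fst_eq h1.symm h))).symm
    · exact lt_irrefl _ hx.1
    · exact lt_irrefl _ hx.2
  ext z
  constructor
  · rintro (⟨hz, w, hw, h1, h2⟩ | ⟨hz, w, hw, h1, h2⟩)
    · exact ⟨hz, hfst hw h1 h2.ne⟩
    · exact ⟨hz, hfst hw h1 h2.ne'⟩
  · rintro ⟨hz, hn⟩
    have hx := fst_mem_Ioo_of_mem_S10 (hA hz) (fun h => hn (Or.inr (Or.inl h)))
      (fun h => hn (Or.inr (Or.inr h)))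
    obtain ⟨w, hw, h1⟩ := hc.exists_mem_attracted_fst_eq ha0 ha1 hx
    rcases lt_trichotomy w.2 z.2 with h | h | h
    · exact Or.inl ⟨hz, w, hw, h1, h⟩
    · exact (hn (Or.inl (by rwa [← Prod.ext h1 h]))).elim
    · exact Or.inr ⟨hz, w, hw, h1, h⟩

lemma mapsTo_above (hc : IsStableCurve a c) (ha0 : 0 < a) (ha1 : a < 1 / 6)
    {A : Set (ℝ × ℝ)} (hA : A ⊆ S10) (hFA : ∀ z, F a z ∈ A ↔ z ∈ A) :
    MapsTo (F a) (above (attracted a) A) (above (attracted a) A) := by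
  rintro z ⟨hz, w, hw, h1, h2⟩
  have hx := hc.fst_mem_Ioo_of_mem_attracted ha0 ha1 hw
  rw [h1] at hx
  refine ⟨(hFA z).2 hz, ?_⟩
  have hFw := (F_mem_attracted_iff w).2 hw
  have hle : DiagLE (F a w) (F a z) :=
    (diagLE_of_fst_eq h1 h2.le).map_F ha0 ha1 (attracted_subset_S10 ha0 ha1 hw) (hA hz)
  have hx' : (F a z).1 ∈ Ioo 0 (2 * Real.pi) := by
    refine fst_mem_Ioo_of_mem_S10 (hA ((hFA z).2 hz)) ?_ ?_
    · rw [Ne, F_eq_iff ha0 ha1 (F_zero a)]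
      rintro rfl
      exact lt_irrefl _ hx.1
    · rw [Ne, F_eq_iff ha0 ha1 (F_two_pi a)]
      rintro rfl
      exact lt_irrefl _ hx.2
  obtain ⟨y, hy, hy1⟩ := hc.exists_mem_attracted_fst_eq ha0 ha1 hx'
  refine ⟨y, hy, hy1, ?_⟩
  -- Otherwise `F w ≤ F z ≤ y` in the order, with both ends in the basin. The ends then coincide and
  -- squeeze `F z` onto `F w`, against injectivity.
  by_contra! hcon
  have hzy : DiagLE (F a z) y := diagLE_of_fst_eq hy1.symm hcon
  have e := eq_of_diagLE ha0 ha1 hFw hy (hle.trans hzy)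
  rw [← e] at hzy
  have : F a w = F a z := ext_diag (le_antisymm hle.1 hzy.1) (le_antisymm hzy.2 hle.2)
  rw [F_injective ha0 ha1 this] at h2
  exact lt_irrefl _ h2

lemma mapsTo_below (hc : IsStableCurve a c) (ha0 : 0 < a) (ha1 : a < 1 / 6)
    {A : Set (ℝ × ℝ)} (hA : A ⊆ S10) (hFA : ∀ z, F a z ∈ A ↔ z ∈ A)
    (hrA : ∀ z, rot z ∈ A ↔ z ∈ A) :
    MapsTo (F a) (below (attracted a) A) (below (attracted a) A) := by
  rw [below_eq_preimage_rot (hc.rot_mem_attracted ha0 ha1) hrA]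
  intro z hz
  rw [mem_preimage, ← F_rot]
  exact hc.mapsTo_above ha0 ha1 hA hFA hz

lemma image_diff_closure (hc : IsStableCurve a c) (ha0 : 0 < a) (ha1 : a < 1 / 6)
    {A : Set (ℝ × ℝ)} (hFA : ∀ z, F a z ∈ A ↔ z ∈ A) :
    F a '' (A \ closure (attracted a)) = A \ closure (attracted a) := by
  refine image_eq_of_mem_iff (F_surjective ha0 ha1) fun z => ?_
  rw [hc.closure_attracted ha0 ha1]
  simp only [Set.mem_sdiff, mem_union, mem_insert_iff, mem_singleton_iff, hFA, F_mem_attracted_iff,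
    F_eq_iff ha0 ha1 (F_zero a), F_eq_iff ha0 ha1 (F_two_pi a)]

lemma image_above (hc : IsStableCurve a c) (ha0 : 0 < a) (ha1 : a < 1 / 6)
    {A : Set (ℝ × ℝ)} (hA : A ⊆ S10) (hFA : ∀ z, F a z ∈ A ↔ z ∈ A)
    (hrA : ∀ z, rot z ∈ A ↔ z ∈ A) :
    F a '' above (attracted a) A = above (attracted a) A :=
  image_eq_of_mapsTo_of_disjoint (hc.above_union_below ha0 ha1 hA)
    (disjoint_above_below ha0 ha1 A) (hc.image_diff_closure ha0 ha1 hFA)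
    (hc.mapsTo_above ha0 ha1 hA hFA) (hc.mapsTo_below ha0 ha1 hA hFA hrA)

lemma image_below (hc : IsStableCurve a c) (ha0 : 0 < a) (ha1 : a < 1 / 6)
    {A : Set (ℝ × ℝ)} (hA : A ⊆ S10) (hFA : ∀ z, F a z ∈ A ↔ z ∈ A)
    (hrA : ∀ z, rot z ∈ A ↔ z ∈ A) :
    F a '' below (attracted a) A = below (attracted a) A :=
  image_eq_of_mapsTo_of_disjoint ((union_comm _ _).trans (hc.above_union_below ha0 ha1 hA))
    (disjoint_above_below ha0 ha1 A).symm (hc.image_diff_closure ha0 ha1 hFA)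
    (hc.mapsTo_below ha0 ha1 hA hFA hrA) (hc.mapsTo_above ha0 ha1 hA hFA)

lemma isOpen_above (hc : IsStableCurve a c) (ha0 : 0 < a) (ha1 : a < 1 / 6) :
    IsOpen (above (attracted a) (interior S10)) := by
  rw [isOpen_iff_mem_nhds]
  rintro z ⟨hz, w, hw, h1, h2⟩
  -- This open cone over `w` lies above the curve, because the curve is 1-Lipschitz.
  have hev : ∀ᶠ y : ℝ × ℝ in 𝓝 z, w.2 + |y.1 - w.1| < y.2 := by
    have hcont : Continuous fun y : ℝ × ℝ => w.2 + |y.1 - w.1| := by fun_prop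
    exact hcont.continuousAt.eventually_lt continuous_snd.continuousAt (by simpa [h1] using h2)
  filter_upwards [isOpen_interior.mem_nhds hz, hev] with y hy hlt
  obtain ⟨⟨k1, k2⟩, k3, k4⟩ := AlignedClocks.mem_interior_S10.1 hy
  obtain ⟨t, ht⟩ := hc.exists_fst_eq ha0 ha1 (x := y.1) (by
    rw [fst_eq]; constructor <;> linarith)
  rw [← hc.range_eq ha0 ha1] at hw
  obtain ⟨s, rfl⟩ := hw
  refine ⟨hy, c t, hc.mem_attracted ha0 ha1 t, ht, ?_⟩
  have hlip := hc.abs_snd_sub_le ha0 ha1 t s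
  rw [ht] at hlip
  linarith [(abs_le.1 hlip).2]

lemma isConnected_above (hc : IsStableCurve a c) (ha0 : 0 < a) (ha1 : a < 1 / 6) :
    IsConnected (above (attracted a) (interior S10)) := by
  have hstrict : ∀ z : ℝ × ℝ, z ∈ interior S10 ↔
      (-z.1 < z.2 ∧ z.1 - 2 * Real.pi < z.2) ∧ z.2 < min z.1 (2 * Real.pi - z.1) := by
    intro z
    rw [AlignedClocks.mem_interior_S10, lt_min_iff]
    simp only [U, V]
    constructor
    · rintro ⟨⟨h1, h2⟩, h3, h4⟩
      refine ⟨⟨?_, ?_⟩, ?_, ?_⟩ <;> linarith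
    · rintro ⟨⟨h1, h2⟩, h3, h4⟩
      refine ⟨⟨?_, ?_⟩, ?_, ?_⟩ <;> linarith
  -- The upper boundary of the square is the graph of `min x (2π - x)`. Interpolating vertically
  -- between the curve and this roof parametrizes the region by a connected strip.
  have himage : above (attracted a) (interior S10) =
      (fun p : ℝ × ℝ => ((c p.1).1, (c p.1).2 +
        p.2 * (min (c p.1).1 (2 * Real.pi - (c p.1).1) - (c p.1).2))) '' (univ ×ˢ Ioo 0 1) := by
    ext z
    constructor
    · rintro ⟨hz, w, hw, h1, h2⟩
      rw [← hc.range_eq ha0 ha1] at hw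
      obtain ⟨t, rfl⟩ := hw
      obtain ⟨-, k⟩ := (hstrict z).1 hz
      rw [← h1] at k
      have hpos : 0 < min (c t).1 (2 * Real.pi - (c t).1) - (c t).2 := by linarith
      refine ⟨(t, (z.2 - (c t).2) / (min (c t).1 (2 * Real.pi - (c t).1) - (c t).2)),
        ⟨mem_univ _, div_pos (by linarith) hpos, (div_lt_one hpos).2 (by linarith)⟩, ?_⟩
      refine Prod.ext h1 ?_
      simp only
      rw [div_mul_cancel₀ _ hpos.ne']
      ring
    · rintro ⟨⟨t, s⟩, ⟨-, hs0, hs1⟩, rfl⟩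
      obtain ⟨⟨k1, k2⟩, k3⟩ := (hstrict (c t)).1 (hc.mem_interior_S10 ha0 ha1 t)
      have hpos : 0 < min (c t).1 (2 * Real.pi - (c t).1) - (c t).2 := by linarith
      have e1 := mul_pos hs0 hpos
      have e2 := mul_lt_of_lt_one_left hpos hs1
      refine ⟨(hstrict _).2 ⟨⟨?_, ?_⟩, ?_⟩, c t, hc.mem_attracted ha0 ha1 t, rfl, ?_⟩ <;>
        dsimp only <;> linarith
  rw [himage]
  refine (isConnected_univ.prod (isConnected_Ioo zero_lt_one)).image _ (Continuous.continuousOn ?_)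
  have := hc.continuous
  fun_prop

theorem splitsInvariantly (hc : IsStableCurve a c) (ha0 : 0 < a) (ha1 : a < 1 / 6) :
    SplitsInvariantly (F a) (attracted a) S10 := by
  have hbelow : below (attracted a) (interior S10) = rot ⁻¹' above (attracted a) (interior S10) :=
    below_eq_preimage_rot (hc.rot_mem_attracted ha0 ha1) fun _ => rot_mem_interior_S10_iff
  refine ⟨hc.isOpen_above ha0 ha1, ?_, hc.isConnected_above ha0 ha1, ?_,
    disjoint_above_below ha0 ha1 _, ?_,
    hc.image_above ha0 ha1 interior_subset (F_mem_interior_S10_iff ha0 ha1)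
      fun _ => rot_mem_interior_S10_iff,
    hc.image_below ha0 ha1 interior_subset (F_mem_interior_S10_iff ha0 ha1)
      fun _ => rot_mem_interior_S10_iff,
    disjoint_above_below ha0 ha1 _, hc.above_union_below ha0 ha1 Subset.rfl,
    hc.image_above ha0 ha1 Subset.rfl (F_mem_S10_iff ha0 ha1) fun _ => rot_mem_S10_iff,
    hc.image_below ha0 ha1 Subset.rfl (F_mem_S10_iff ha0 ha1) fun _ => rot_mem_S10_iff⟩
  · rw [hbelow]
    exact (hc.isOpen_above ha0 ha1).preimage continuous_rot
  · rw [hbelow, ← image_rot]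
    exact (hc.isConnected_above ha0 ha1).image _ continuous_rot.continuousOn
  · rw [hc.above_union_below ha0 ha1 interior_subset, hc.closure_attracted ha0 ha1]
    ext z
    refine ⟨fun h => ⟨h.1, fun h' => h.2 (Or.inl h')⟩, fun h => ⟨h.1, ?_⟩⟩
    obtain ⟨⟨k1, k2⟩, k3, k4⟩ := AlignedClocks.mem_interior_S10.1 h.1
    rintro (h' | rfl | rfl)
    · exact h.2 h'
    · simp [U] at k1
    · simp [U] at k2

lemma image_Iio_union_image_Ioi (hc : IsStableCurve a c) (ha0 : 0 < a) (ha1 : a < 1 / 6) :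
    c '' Iio 0 ∪ c '' Ioi 0 ∪ {(Real.pi, 0)} = attracted a := by
  rw [← hc.range_eq ha0 ha1, ← hc.zero, ← image_singleton, ← image_union, ← image_union,
    ← image_univ]
  congr 1
  ext t
  simp only [mem_union, mem_Iio, mem_Ioi, mem_singleton_iff, mem_univ, iff_true]
  rcases lt_trichotomy t 0 with h | h | h <;> tauto

lemma image_Ioi (hc : IsStableCurve a c) : c '' Ioi 0 = rot '' (c '' Iio 0) := by
  rw [image_image]
  simp only [← hc.neg]
  rw [← image_image c Neg.neg, image_neg_eq_neg, neg_Iio, neg_zero]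

lemma attracted_inter_s1 (hc : IsStableCurve a c) (ha0 : 0 < a) (ha1 : a < 1 / 6) :
    attracted a ∩ s1 = c '' Iio 0 ∪ {(Real.pi, 0)} := by
  have hpi := Real.pi_pos
  ext z
  constructor
  · rintro ⟨hz, hs⟩
    rw [← hc.image_Iio_union_image_Ioi ha0 ha1] at hz
    rcases hz with (hz | ⟨t, ht, rfl⟩) | hz
    · exact Or.inl hz
    · have h4 := AlignedClocks.mem_interior_s4.1 (hc.mem_interior_s4 ha0 ha1 ht)
      have h1 := mem_s1.1 hs
      linarith [h4.1.1, h1.1.2]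
    · exact Or.inr hz
  · rintro (⟨t, ht, rfl⟩ | rfl)
    · exact ⟨hc.mem_attracted ha0 ha1 t, interior_subset (hc.mem_interior_s1 ha0 ha1 ht)⟩
    · refine ⟨hc.zero ▸ hc.mem_attracted ha0 ha1 0, mem_s1.2 ?_⟩
      rw [U_saddle, V_saddle]
      constructor <;> constructor <;> linarith

lemma attracted_inter_interior_s1 (hc : IsStableCurve a c) (ha0 : 0 < a) (ha1 : a < 1 / 6) :
    attracted a ∩ interior s1 = c '' Iio 0 := by
  ext z
  constructor
  · rintro ⟨hz, hs⟩
    have : z ∈ attracted a ∩ s1 := ⟨hz, interior_subset hs⟩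
    rw [hc.attracted_inter_s1 ha0 ha1] at this
    refine this.resolve_right ?_
    rintro rfl
    have := (AlignedClocks.mem_interior_s1.1 hs).1.2
    rw [U_saddle] at this
    exact lt_irrefl _ this
  · rintro ⟨t, ht, rfl⟩
    exact ⟨hc.mem_attracted ha0 ha1 t, hc.mem_interior_s1 ha0 ha1 ht⟩

lemma isHeteroclinicCurve_left (hc : IsStableCurve a c) (ha0 : 0 < a) (ha1 : a < 1 / 6) :
    IsHeteroclinicCurve (F a) (0, 0) (Real.pi, 0) (c '' Iio 0) :=
  isHeteroclinicCurve_image_Iio (stableEig_pos ha0 ha1) (stableEig_lt_one ha0) hc.smooth hc.zero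
    hc.map (hc.tendsto_atBot ha0 ha1) (F_zero a)
    fun h => Real.pi_pos.ne (congrArg Prod.fst h)

lemma isHeteroclinicCurve_right (hc : IsStableCurve a c) (ha0 : 0 < a) (ha1 : a < 1 / 6) :
    IsHeteroclinicCurve (F a) (2 * Real.pi, 0) (Real.pi, 0) (c '' Ioi 0) := by
  have e : c '' Ioi 0 = (fun t => c (-t)) '' Iio 0 := by
    rw [← image_image c Neg.neg, image_neg_eq_neg, neg_Iio, neg_zero]
  rw [e]
  refine isHeteroclinicCurve_image_Iio (stableEig_pos ha0 ha1) (stableEig_lt_one ha0)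
    ⟨hc.smooth.1.comp contDiff_neg, fun s t h => neg_injective (hc.smooth.2.1 h), fun t => ?_⟩
    (by rw [neg_zero, hc.zero]) (fun t => by rw [hc.map, mul_neg])
    ((hc.tendsto_atTop ha0 ha1).comp tendsto_neg_atBot_atTop) (F_two_pi a) fun h => ?_
  · rw [deriv_comp_neg]
    exact neg_ne_zero.2 (hc.smooth.2.2 _)
  · have := congrArg Prod.fst h
    simp only at this
    linarith [Real.pi_pos]

end IsStableCurve

end

end AlignedClocks
open AlignedClocks in
theorem theorem1 (a : ℝ) (ha0 : 0 < a) (ha1 : a < 1 / 6) :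
    IsUnstableNode (F a) (0, 0) ∧ IsUnstableNode (F a) (2 * Real.pi, 0) ∧
    IsSaddle (F a) (Real.pi, 0) ∧ F a '' S10 = S10 ∧
    ∃ γL γR : Set (ℝ × ℝ),
      -- the heteroclinic curve on the left, in the small square `s1`
      IsHeteroclinicCurve (F a) (0, 0) (Real.pi, 0) γL ∧ γL ⊆ interior s1 ∧
      -- its image under the internal symmetry, in the small square `s4`
      γR = rot '' γL ∧
      IsHeteroclinicCurve (F a) (2 * Real.pi, 0) (Real.pi, 0) γR ∧ γR ⊆ interior s4 ∧
      -- they are the branches of the global stable manifold of the saddle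
      (∀ U ∈ 𝓝 ((Real.pi, 0) : ℝ × ℝ),
        stableManifold (F a) (Real.pi, 0) U ∩ interior s1 = γL ∧
        stableManifold (F a) (Real.pi, 0) U ∩ s1 = γL ∪ {(Real.pi, 0)} ∧
        stableManifold (F a) (Real.pi, 0) U = γL ∪ γR ∪ {(Real.pi, 0)}) ∧
      -- which is a smooth curve tangent to the stable direction at the saddle
      (∃ c : ℝ → ℝ × ℝ, IsSmoothCurve c ∧ c 0 = (Real.pi, 0) ∧ deriv c 0 = (2 + √3, 1) ∧
        c '' Iio 0 = γL ∧ c '' Ioi 0 = γR) ∧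
      -- and together they split the square
      closure (γL ∪ γR ∪ {(Real.pi, 0)}) =
        γL ∪ γR ∪ {(Real.pi, 0), (0, 0), (2 * Real.pi, 0)} ∧
      SplitsInvariantly (F a) (γL ∪ γR ∪ {(Real.pi, 0)}) S10 := by
  obtain ⟨c, hc⟩ := exists_isStableCurve ha0 ha1
  refine ⟨isUnstableNode_of_cos_eq_one ha0 (F_zero a) (by simp) (by simp),
    isUnstableNode_of_cos_eq_one ha0 (F_two_pi a) (by simp) (by simp), isSaddle_pi ha0 ha1,
    image_eq_of_mem_iff (F_surjective ha0 ha1) (F_mem_S10_iff ha0 ha1), c '' Iio 0, c '' Ioi 0,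
    hc.isHeteroclinicCurve_left ha0 ha1, ?_, hc.image_Ioi, hc.isHeteroclinicCurve_right ha0 ha1,
    ?_, fun W hW => ?_, ⟨c, hc.smooth, hc.zero, hc.hasDerivAt.deriv, rfl, rfl⟩, ?_, ?_⟩
  · rintro _ ⟨t, ht, rfl⟩
    exact hc.mem_interior_s1 ha0 ha1 ht
  · rintro _ ⟨t, ht, rfl⟩
    exact hc.mem_interior_s4 ha0 ha1 ht
  · rw [stableManifold_eq_attracted a hW]
    exact ⟨hc.attracted_inter_interior_s1 ha0 ha1, hc.attracted_inter_s1 ha0 ha1,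
      (hc.image_Iio_union_image_Ioi ha0 ha1).symm⟩
  · rw [← singleton_union, ← union_assoc, hc.image_Iio_union_image_Ioi ha0 ha1,
      hc.closure_attracted ha0 ha1]
  · rw [hc.image_Iio_union_image_Ioi ha0 ha1]
    exact hc.splitsInvariantly ha0 ha1
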